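/- **Setting.** Let $d,p\in\mathbb N$, $T>0$, $C_0\ge 0$, $L\ge 0$, and let $|\cdot|$ be the Euclidean norm, $\|\cdot\|$ the induced matrix norm. Let $A$ be a non-empty compact subset of a separable metric space. Let $\mu:[0,T]\times\mathbb R^d\times A\to\mathbb R^d$ and $\sigma:[0,T]\times\mathbb R^d\times A\to\mathbb R^{d\times p}$ be continuous with $$|\mu(t,x,a)-\mu(s,y,a)|+\|\sigma(t,x,a)-\sigma(s,y,a)\|\le C_0\big(|x-y|+|t-s|^{1/2}\big),$$ and let $\psi:\mathbb R^d\to\mathbb R$ satisfy $|\psi(x)-\psi(y)|\le L|x-y|$, for all $s,t\in[0,T]$, $x,y\in\mathbb R^d$, $a\in A$ (the running cost is $0$). Let $B$ be an $\mathbb R^p$-valued Brownian motion with respect to a filtration $\mathbb F$ on a probability space (for instance the filtration induced by $B$). For $N\ge1$ put $h=T/N$, $t_n=nh$, $\Delta B_i=B_{t_{i+1}}-B_{t_i}$. Let $\mathcal A_h$ be the set of progressively measurable $A$-valued processes that are constant on each $[t_i,t_{i+1})$, $0\le i<N$, and, for $\varepsilon>0$, let $\mathcal E_h$ be the set of progressively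 measurable $\mathbb R^d$-valued processes bounded by $\varepsilon$ that are constant on each $[t_i,t_{i+1})$; write $a_i=\alpha_{t_i}$, $e_i=e_{t_i}$. Given $(\alpha,e)\in\mathcal A_h\times\mathcal E_h$, let $\widetilde X=\widetilde X^{t_n,x,\alpha,e}$ be defined by $\widetilde X_{t_n}=x$ and $$\widetilde X_{t_{i+1}}=\widetilde X_{t_i}+\mu(t_i,\widetilde X_{t_i}+e_i,a_i)\,h+\sigma(t_i,\widetilde X_{t_i}+e_i,a_i)\,\Delta B_i,\qquad i=n,\dots,N-1,$$ and let $\widetilde X^{t_n,x,\alpha}=\widetilde X^{t_n,x,\alpha,0}$. Put $$v^\varepsilon(t_n,x)=\sup_{\alpha\in\mathcal A_h,\,e\in\mathcal E_h}\mathbb E\big[\psi(\widetilde X^{t_n,x,\alpha,e}_T)\big],\qquad v_\varepsilon(t_n,x)=\int_{\mathbb R^d}v^\varepsilon(t_n,x-\xi)\,\delta_\varepsilon(\xi)\,d\xi,\qquad n=0,\dots,N,$$ where $\delta_\varepsilon(x)=\varepsilon^{-d}\delta(x/\varepsilon)$ and $\delta:\mathbb R^d\to[0,\infty)$ is $C^\infty$,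 supported in the unit ball, with $\int\delta=1$. **Proposition.** All expectations, suprema and integrals in these definitions and in (iii) below are well defined and finite, and: 1. (i) There is $C\ge0$, depending only on $d,p,T,C_0$, such that $|v_\varepsilon(t_n,x)-v^\varepsilon(t_n,x)|\le LC\varepsilon$ for all $n=0,\dots,N$ and $x\in\mathbb R^d$. 2. (ii) $v_\varepsilon(t_n,\cdot)$ is $C^\infty$ for $n=0,\dots,N$, and for every $k\ge1$ there is $C\ge0$, depending only on $d,p,T,C_0,\delta,k$, such that $\sup_{n=0,\dots,N}\|D^{(k)}v_\varepsilon(t_n,\cdot)\|_\infty\le LC\varepsilon^{1-k}$. 3. (iii) For all $n=0,\dots,N-1$ and $x\in\mathbb R^d$, $\ v_\varepsilon(t_n,x)\ge\sup_{a\in A}\mathbb E\big[v_\varepsilon(t_{n+1},\widetilde X^{t_n,x,a}_{t_{n+1}})\big]$, where $a$ also denotes the constant control. -/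

import Mathlib

open MeasureTheory ProbabilityTheory Set
open scoped NNReal

noncomputable section

namespace ShakenControl

/-- `ℝⁿ` with the Euclidean norm. -/
abbrev E (n : ℕ) : Type := EuclideanSpace ℝ (Fin n)

/-- The data of the control problem (with zero running cost): the set `A` of control values inside
a metric space `𝔸`, the drift `μ`, the diffusion coefficient `σ` (a `d × p` matrix, regarded as a
linear map `ℝᵖ → ℝᵈ`, so that its norm is the matrix norm induced by the Euclidean norms) and the
terminal cost `ψ`. -/
structure ControlProblem (d p : ℕ) (𝔸 : Type*) where
  A : Set 𝔸
  μ : ℝ≥0 → E d → 𝔸 → E d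
  σ : ℝ≥0 → E d → 𝔸 → (E p →L[ℝ] E d)
  ψ : E d → ℝ

/-- The standing assumptions (H1), (H2), (H3) on the horizon `[0, T]`, with constants `C₀` and `L`
and with running cost `g ≡ 0`. -/
structure ControlProblem.Assumptions {d p : ℕ} {𝔸 : Type*} [MetricSpace 𝔸]
    (Q : ControlProblem d p 𝔸) (T : ℝ≥0) (C₀ L : ℝ) : Prop where
  nonempty : Q.A.Nonempty
  isCompact : IsCompact Q.A
  continuousOn_μ : ContinuousOn (fun q : ℝ≥0 × E d × 𝔸 => Q.μ q.1 q.2.1 q.2.2)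
    (Icc 0 T ×ˢ univ ×ˢ Q.A)
  continuousOn_σ : ContinuousOn (fun q : ℝ≥0 × E d × 𝔸 => Q.σ q.1 q.2.1 q.2.2)
    (Icc 0 T ×ˢ univ ×ˢ Q.A)
  coeff_bound : ∀ t ∈ Icc 0 T, ∀ s ∈ Icc 0 T, ∀ x y : E d, ∀ a ∈ Q.A,
    ‖Q.μ t x a - Q.μ s y a‖ + ‖Q.σ t x a - Q.σ s y a‖
      ≤ C₀ * (‖x - y‖ + Real.sqrt |(t : ℝ) - (s : ℝ)|)
  L_nonneg : 0 ≤ L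
  cost_bound : ∀ x y : E d, |Q.ψ x - Q.ψ y| ≤ L * ‖x - y‖

variable {d p : ℕ} {𝔸 Ω : Type*} {mΩ : MeasurableSpace Ω}

/-- `B` is a standard `ℝᵖ`-valued Brownian motion with respect to the filtration `𝓕`. -/
structure IsBrownianMotion (B : ℝ≥0 → Ω → E p) (𝓕 : Filtration ℝ≥0 mΩ) (P : Measure Ω) :
    Prop where
  adapted : StronglyAdapted 𝓕 B
  zero : ∀ᵐ ω ∂P, B 0 ω = 0
  continuous : ∀ᵐ ω ∂P, Continuous fun t => B t ω
  indep : ∀ s t : ℝ≥0, s ≤ t →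
    Indep (MeasurableSpace.comap (fun ω => B t ω - B s ω) inferInstance) (𝓕 s) P
  law : ∀ s t : ℝ≥0, s ≤ t →
    HasLaw (fun ω => B t ω - B s ω)
      ((stdGaussian (E p)).map fun z => Real.sqrt ((t : ℝ) - (s : ℝ)) • z) P

/-- The time step `h = T / N`. -/
def timeStep (T : ℝ≥0) (N : ℕ) : ℝ≥0 := T / N

/-- The mesh point `t_n = n h`. -/
def meshTime (T : ℝ≥0) (N n : ℕ) : ℝ≥0 := n * timeStep T N

/-- A process is constant (in time) on each interval `[t_i, t_{i+1})`, `i = 0, …, N - 1`. -/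
def IsPiecewiseConstant {β : Type*} (T : ℝ≥0) (N : ℕ) (u : ℝ≥0 → Ω → β) : Prop :=
  ∀ ω, ∀ i < N, ∀ s ∈ Ico (meshTime T N i) (meshTime T N (i + 1)),
    u s ω = u (meshTime T N i) ω

/-- The class `𝒜_h`: progressively measurable `A`-valued processes, constant on each
`[t_i, t_{i+1})`. -/
def controls [MetricSpace 𝔸] (A : Set 𝔸) (T : ℝ≥0) (N : ℕ) (𝓕 : Filtration ℝ≥0 mΩ) :
    Set (ℝ≥0 → Ω → 𝔸) :=
  {α | IsStronglyProgressive 𝓕 α ∧ (∀ s ω, α s ω ∈ A) ∧ IsPiecewiseConstant T N α}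

/-- The class `ℰ_h`: progressively measurable `ℝᵈ`-valued processes bounded by `ε`, constant on
each `[t_i, t_{i+1})`. -/
def perturbations (d : ℕ) (ε : ℝ) (T : ℝ≥0) (N : ℕ) (𝓕 : Filtration ℝ≥0 mΩ) :
    Set (ℝ≥0 → Ω → E d) :=
  {e | IsStronglyProgressive 𝓕 e ∧ (∀ s ω, ‖e s ω‖ ≤ ε) ∧ IsPiecewiseConstant T N e}

/-- The perturbed Euler-Maruyama chain `i ↦ X̃_{t_i}` with control `α` and perturbation `e`, started
at time `t_n` from `x`. (For `i ≤ n` its value is `x`.) -/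
def perturbedEuler (Q : ControlProblem d p 𝔸) (T : ℝ≥0) (N : ℕ) (B : ℝ≥0 → Ω → E p)
    (α : ℝ≥0 → Ω → 𝔸) (e : ℝ≥0 → Ω → E d) (n : ℕ) (x : E d) : ℕ → Ω → E d
  | 0 => fun _ => x
  | i + 1 => fun ω =>
      if n ≤ i then
        let X := perturbedEuler Q T N B α e n x i ω
        let t := meshTime T N i
        X + (timeStep T N : ℝ) • Q.μ t (X + e t ω) (α t ω)
          + Q.σ t (X + e t ω) (α t ω) (B (meshTime T N (i + 1)) ω - B t ω)
      else x

/-- The (unperturbed) Euler-Maruyama chain. -/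
def euler (Q : ControlProblem d p 𝔸) (T : ℝ≥0) (N : ℕ) (B : ℝ≥0 → Ω → E p)
    (α : ℝ≥0 → Ω → 𝔸) (n : ℕ) (x : E d) : ℕ → Ω → E d :=
  perturbedEuler Q T N B α (fun _ _ => 0) n x

/-- The perturbed value function
`v^ε(t_n, x) = sup { E[ψ(X̃_T)] : α ∈ 𝒜_h, e ∈ ℰ_h }`. -/
def perturbedValue [MetricSpace 𝔸] (Q : ControlProblem d p 𝔸) (T : ℝ≥0) (N : ℕ)
    (𝓕 : Filtration ℝ≥0 mΩ) (P : Measure Ω) (B : ℝ≥0 → Ω → E p) (ε : ℝ) (n : ℕ) (x : E d) : ℝ :=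
  ⨆ q : controls Q.A T N 𝓕 × perturbations d ε T N 𝓕,
    ∫ ω, Q.ψ (perturbedEuler Q T N B q.1 q.2 n x N ω) ∂P

/-- A smooth nonnegative function with integral one, supported in the unit ball. -/
structure IsMollifier (δ : E d → ℝ) : Prop where
  smooth : ContDiff ℝ (⊤ : ℕ∞) δ
  nonneg : ∀ x, 0 ≤ δ x
  support_subset : Function.support δ ⊆ Metric.closedBall 0 1
  integral_eq_one : ∫ x, δ x = 1

/-- The rescaled mollifier `δ_ε(x) = ε^{-d} δ(x / ε)`. -/
def scaledMollifier (δ : E d → ℝ) (ε : ℝ) (x : E d) : ℝ := (ε ^ d)⁻¹ * δ (ε⁻¹ • x)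

/-- The mollified perturbed value function
`v_ε(t_n, x) = ∫ v^ε(t_n, x - ξ) δ_ε(ξ) dξ`. -/
def mollifiedValue [MetricSpace 𝔸] (Q : ControlProblem d p 𝔸) (T : ℝ≥0) (N : ℕ)
    (𝓕 : Filtration ℝ≥0 mΩ) (P : Measure Ω) (B : ℝ≥0 → Ω → E p) (δ : E d → ℝ) (ε : ℝ)
    (n : ℕ) (x : E d) : ℝ :=
  ∫ ξ, perturbedValue Q T N 𝓕 P B ε n (x - ξ) * scaledMollifier δ ε ξ

/-- All quantities that enter the definitions of `v^ε` and `v_ε` are well defined: the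
expectations of the costs exist, their supremum is finite, and the mollification integrals
converge. -/
def ValuesWellDefined [MetricSpace 𝔸] (Q : ControlProblem d p 𝔸) (T : ℝ≥0) (N : ℕ)
    (𝓕 : Filtration ℝ≥0 mΩ) (P : Measure Ω) (B : ℝ≥0 → Ω → E p) (δ : E d → ℝ) (ε : ℝ) : Prop :=
  ∀ n ≤ N, ∀ x : E d,
    (∀ α ∈ controls Q.A T N 𝓕, ∀ e ∈ perturbations d ε T N 𝓕,
      Integrable (fun ω => Q.ψ (perturbedEuler Q T N B α e n x N ω)) P) ∧
    BddAbove (range fun q : controls Q.A T N 𝓕 × perturbations d ε T N 𝓕 =>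
      ∫ ω, Q.ψ (perturbedEuler Q T N B q.1 q.2 n x N ω) ∂P) ∧
    Integrable fun ξ : E d => perturbedValue Q T N 𝓕 P B ε n (x - ξ) * scaledMollifier δ ε ξ

end ShakenControl

end

/-! The value `v^ε(t_n, ·)` solves a backward recursion: `dpValue` with `N - n` steps remaining,
each step replacing `W` by the supremum over (control value, perturbation value) of the mean of `W`
after one Euler step. The upper bound conditions on the past (`integral_comp_eulerStep`). The lower
bound drives the chain by measurable, almost optimal feedback (`exists_feedback`,
`exists_dpValue_sub_le_integral_cost`). Together they give `perturbedValue_eq_dpValue`, after which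
no process is needed for (i) and (ii).

One Euler step multiplies a Lipschitz constant by at most `exp (lipRate p C₀ * h)`: the drift
contributes `C₀ h`, and the centred noise enters only through its variance, of order `h`. Over at
most `N` steps the factor stays below `lipConst p T C₀`, uniformly in `N` and `ε`. Parts (i) and
(ii) are then facts about mollifying a Lipschitz function. For (ii), subtracting the constant `W x`
before differentiating gains one power of `ε` (`norm_iteratedFDeriv_mollify_le`).

Part (iii) is the reason for shaking the coefficients (`oneStep_mollify_le`). From `x - ξ` with `‖ξ‖
≤ ε`, the perturbation `e = ξ` is admissible and makes the coefficients be evaluated at `x`. That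
step is the unperturbed step from `x`, translated by `-ξ`. Averaging over `ξ` against `δ_ε` and
exchanging the integrals (`stepMean_mollify`) gives the inequality. -/

noncomputable section

namespace ShakenControl

/-! ### Moments of Gaussian increments. -/

variable {d p : ℕ}

/-- The law of a Brownian increment over a time interval of length `r`. -/
def noiseLaw (p : ℕ) (r : ℝ) : Measure (E p) :=
  (stdGaussian (E p)).map fun z => Real.sqrt r • z

instance (p : ℕ) (r : ℝ) : IsProbabilityMeasure (noiseLaw p r) :=
  Measure.isProbabilityMeasure_map (by fun_prop)

theorem memLp_two_noiseLaw (r : ℝ) : MemLp (fun z : E p => z) 2 (noiseLaw p r) := by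
  rw [noiseLaw, memLp_map_measure_iff (by fun_prop) (by fun_prop)]
  exact (IsGaussian.memLp_two_id (μ := stdGaussian (E p))).const_smul (Real.sqrt r)

theorem integrable_noiseLaw (r : ℝ) : Integrable (fun z : E p => z) (noiseLaw p r) :=
  (memLp_two_noiseLaw r).integrable one_le_two

theorem integral_noiseLaw (r : ℝ) : ∫ z, z ∂(noiseLaw p r) = 0 := by
  rw [noiseLaw, integral_map (by fun_prop) (by fun_prop), integral_smul,
    integral_id_stdGaussian, smul_zero]

theorem integral_coord_sq_stdGaussian (i : Fin p) :
    ∫ z : E p, (z i) ^ 2 ∂(stdGaussian (E p)) = 1 := by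
  have h := variance_dual_stdGaussian (innerSL ℝ (EuclideanSpace.single i (1 : ℝ)) : E p →L[ℝ] ℝ)
  rw [variance_of_integral_eq_zero (by fun_prop) (integral_strongDual_stdGaussian _)] at h
  simpa [EuclideanSpace.inner_single_left] using h

theorem integral_norm_sq_stdGaussian :
    ∫ z : E p, ‖z‖ ^ 2 ∂(stdGaussian (E p)) = p := by
  simp_rw [EuclideanSpace.real_norm_sq_eq]
  rw [integral_finsetSum]
  · simp [integral_coord_sq_stdGaussian]
  · intro i _
    have h := (IsGaussian.memLp_two_id (μ := stdGaussian (E p))).continuousLinearMap_comp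
      (innerSL ℝ (EuclideanSpace.single i (1 : ℝ)) : E p →L[ℝ] ℝ)
    simpa [EuclideanSpace.inner_single_left] using h.integrable_sq

theorem integral_norm_sq_noiseLaw {r : ℝ} (hr : 0 ≤ r) :
    ∫ z : E p, ‖z‖ ^ 2 ∂(noiseLaw p r) = p * r := by
  rw [noiseLaw, integral_map (by fun_prop) (by fun_prop)]
  simp_rw [norm_smul, mul_pow, integral_const_mul, integral_norm_sq_stdGaussian, Real.norm_eq_abs,
    sq_abs, Real.sq_sqrt hr]
  ring

theorem integrable_norm_sq_noiseLaw (r : ℝ) :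
    Integrable (fun z : E p => ‖z‖ ^ 2) (noiseLaw p r) :=
  (memLp_two_noiseLaw r).integrable_norm_pow (by norm_num)

theorem integrable_affine_noiseLaw (r : ℝ) (m : E d) (s : E p →L[ℝ] E d) :
    Integrable (fun z => m + s z) (noiseLaw p r) :=
  (integrable_const m).add (s.integrable_comp (integrable_noiseLaw r))

/-- Jensen bounds the first moment by the second, and the cross term vanishes because the noise is
centred. The noise thus adds to `‖m‖ ^ 2` a term of order `r`; a triangle inequality would cost
order `√r` per step, which is not summable over the mesh. -/
theorem integral_norm_affine_le {r : ℝ} (hr : 0 ≤ r) (m : E d) (s : E p →L[ℝ] E d) :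
    ∫ z, ‖m + s z‖ ∂(noiseLaw p r) ≤ Real.sqrt (‖m‖ ^ 2 + ‖s‖ ^ 2 * (p * r)) := by
  have hL : MemLp (fun z => m + s z) 2 (noiseLaw p r) :=
    (memLp_const m).add (s.comp_memLp' (memLp_two_noiseLaw r))
  have hsq : Integrable (fun z => ‖m + s z‖ ^ 2) (noiseLaw p r) :=
    hL.integrable_norm_pow (by norm_num)
  -- Jensen's inequality, read off from nonnegativity of the variance of `‖m + s z‖`.
  have h1 : (∫ z, ‖m + s z‖ ∂(noiseLaw p r)) ^ 2 ≤ ∫ z, ‖m + s z‖ ^ 2 ∂(noiseLaw p r) := by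
    have := variance_nonneg (fun z => ‖m + s z‖) (noiseLaw p r)
    rw [variance_eq_sub hL.norm] at this
    simpa using this
  have hs : Integrable (fun z => s z) (noiseLaw p r) := s.integrable_comp (integrable_noiseLaw r)
  have hcross : ∫ z, 2 * inner ℝ m (s z) ∂(noiseLaw p r) = 0 := by
    rw [integral_const_mul, integral_inner hs, s.integral_comp_comm (integrable_noiseLaw r),
      integral_noiseLaw]
    simp
  have hs2 : Integrable (fun z => ‖s z‖ ^ 2) (noiseLaw p r) :=
    (s.comp_memLp' (memLp_two_noiseLaw r)).integrable_norm_pow (by norm_num)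
  have h2 : ∫ z, ‖m + s z‖ ^ 2 ∂(noiseLaw p r) = ‖m‖ ^ 2 + ∫ z, ‖s z‖ ^ 2 ∂(noiseLaw p r) := by
    simp_rw [norm_add_sq_real]
    have hi : Integrable (fun z => 2 * inner ℝ m (s z)) (noiseLaw p r) :=
      (hs.const_inner m).const_mul 2
    have hi' : Integrable (fun z => ‖m‖ ^ 2 + 2 * inner ℝ m (s z)) (noiseLaw p r) :=
      (integrable_const _).add hi
    rw [integral_add hi' hs2, integral_add (integrable_const _) hi, hcross]
    simp
  have h3 : ∫ z, ‖s z‖ ^ 2 ∂(noiseLaw p r) ≤ ‖s‖ ^ 2 * (p * r) := by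
    rw [← integral_norm_sq_noiseLaw hr, ← integral_const_mul]
    refine integral_mono hs2 ((integrable_norm_sq_noiseLaw r).const_mul _) fun z => ?_
    simp only [← mul_pow]
    exact pow_le_pow_left₀ (norm_nonneg _) (s.le_opNorm z) 2
  exact Real.le_sqrt_of_sq_le (by linarith)

/-! ### Averaging a Lipschitz function over one Gaussian step. -/

theorem continuous_of_abs_sub_le {W : E d → ℝ} {K : ℝ} (hW : ∀ x y, |W x - W y| ≤ K * ‖x - y‖) :
    Continuous W :=
  (LipschitzWith.of_dist_le' (K := K) fun x y => by
    rw [Real.dist_eq, dist_eq_norm]; exact hW x y).continuous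

/-- A Lipschitz function of an integrable random vector is integrable. -/
theorem integrable_comp_of_abs_sub_le {Ω : Type*} {mΩ : MeasurableSpace Ω} {P : Measure Ω}
    [IsFiniteMeasure P] {W : E d → ℝ} {K : ℝ}
    (hW : ∀ x y, |W x - W y| ≤ K * ‖x - y‖) {X : Ω → E d} (hX : Integrable X P) :
    Integrable (fun ω => W (X ω)) P := by
  refine Integrable.mono' ((integrable_const |W 0|).add (hX.norm.const_mul K))
    ((continuous_of_abs_sub_le hW).comp_aestronglyMeasurable hX.1) (ae_of_all _ fun ω => ?_)
  have := hW (X ω) 0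
  rw [sub_zero] at this
  have h2 := abs_sub_abs_le_abs_sub (W (X ω)) (W 0)
  simp only [Real.norm_eq_abs, Pi.add_apply]
  linarith

/-- The expectation of `W (m + s z)` when `z` is a Brownian increment over time `r`. -/
def stepMean (r : ℝ) (W : E d → ℝ) (m : E d) (s : E p →L[ℝ] E d) : ℝ :=
  ∫ z, W (m + s z) ∂(noiseLaw p r)

theorem stepMean_zero_zero (r : ℝ) (W : E d → ℝ) :
    stepMean r W 0 (0 : E p →L[ℝ] E d) = W 0 := by
  simp [stepMean]

/-- Synchronous coupling: both steps use the same increment `z`, so their difference is again affine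
in `z`. -/
theorem abs_stepMean_sub_le {r : ℝ} (hr : 0 ≤ r) {W : E d → ℝ} {K : ℝ} (hK : 0 ≤ K)
    (hW : ∀ x y, |W x - W y| ≤ K * ‖x - y‖) (m m' : E d) (s s' : E p →L[ℝ] E d) :
    |stepMean r W m s - stepMean r W m' s'|
      ≤ K * Real.sqrt (‖m - m'‖ ^ 2 + ‖s - s'‖ ^ 2 * (p * r)) := by
  have hi := integrable_comp_of_abs_sub_le hW (integrable_affine_noiseLaw (p := p) r m s)
  have hi' := integrable_comp_of_abs_sub_le hW (integrable_affine_noiseLaw (p := p) r m' s')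
  rw [stepMean, stepMean, ← integral_sub hi hi']
  calc _ ≤ ∫ z, |W (m + s z) - W (m' + s' z)| ∂(noiseLaw p r) := abs_integral_le_integral_abs
    _ ≤ ∫ z, K * ‖(m - m') + (s - s') z‖ ∂(noiseLaw p r) := by
        refine integral_mono (hi.sub hi').abs
          ((integrable_affine_noiseLaw r _ _).norm.const_mul K) fun z => ?_
        refine (hW _ _).trans_eq ?_
        congr 2
        simp only [sub_apply]
        abel
    _ ≤ _ := by
        rw [integral_const_mul]
        exact mul_le_mul_of_nonneg_left (integral_norm_affine_le hr _ _) hK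

theorem continuous_stepMean {r : ℝ} (hr : 0 ≤ r) {W : E d → ℝ} {K : ℝ} (hK : 0 ≤ K)
    (hW : ∀ x y, |W x - W y| ≤ K * ‖x - y‖) :
    Continuous fun q : E d × (E p →L[ℝ] E d) => stepMean r W q.1 q.2 := by
  rw [continuous_iff_continuousAt]
  intro q
  rw [ContinuousAt, tendsto_iff_dist_tendsto_zero]
  refine squeeze_zero (fun _ => dist_nonneg)
    (fun q' => (Real.dist_eq _ _).trans_le (abs_stepMean_sub_le hr hK hW _ _ _ _)) ?_
  have : Continuous fun q' : E d × (E p →L[ℝ] E d) =>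
      K * Real.sqrt (‖q'.1 - q.1‖ ^ 2 + ‖q'.2 - q.2‖ ^ 2 * (p * r)) := by fun_prop
  simpa using this.tendsto q

/-- Freezing: if `Z` is independent of `m`, the pair `(Y, S)` is `m`-measurable and `Z` is a
Brownian increment, then `Y`, `S` may be frozen when averaging over `Z`. -/
theorem integral_comp_eq_integral_stepMean {Ω : Type*} {m mΩ : MeasurableSpace Ω}
    {P : Measure Ω} [IsProbabilityMeasure P] (hm : m ≤ mΩ) {r : ℝ} {Z : Ω → E p}
    (hZ : HasLaw Z (noiseLaw p r) P)
    (hind : Indep (MeasurableSpace.comap Z inferInstance) m P)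
    {Y : Ω → E d} {S : Ω → E p →L[ℝ] E d} (hY : Measurable[m] Y) (hS : Measurable[m] S)
    {W : E d → ℝ} (hW : Continuous W) (hint : Integrable (fun ω => W (Y ω + S ω (Z ω))) P) :
    Integrable (fun ω => stepMean r W (Y ω) (S ω)) P ∧
    ∫ ω, W (Y ω + S ω (Z ω)) ∂P = ∫ ω, stepMean r W (Y ω) (S ω) ∂P := by
  have hYS : Measurable[m] fun ω => (Y ω, S ω) := hY.prodMk hS
  have hYS' : Measurable fun ω => (Y ω, S ω) := hYS.mono hm le_rfl
  have hindep : IndepFun (fun ω => (Y ω, S ω)) Z P := by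
    rw [IndepFun_iff_Indep]
    exact indep_of_indep_of_le_left hind.symm hYS.comap_le
  -- Independence turns the joint law into a product, so Fubini integrates out the increment first.
  have hlaw := hindep.map_prod_eq_prod_map_map hYS'.aemeasurable hZ.aemeasurable
  rw [hZ.map_eq] at hlaw
  have hcont : Continuous fun q : (E d × (E p →L[ℝ] E d)) × E p => W (q.1.1 + q.1.2 q.2) := by
    fun_prop
  have hae : AEMeasurable (fun ω => ((Y ω, S ω), Z ω)) P := hYS'.aemeasurable.prodMk hZ.aemeasurable
  have : IsProbabilityMeasure (P.map fun ω => (Y ω, S ω)) :=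
    Measure.isProbabilityMeasure_map hYS'.aemeasurable
  have hint2 : Integrable (fun q : (E d × (E p →L[ℝ] E d)) × E p => W (q.1.1 + q.1.2 q.2))
      ((P.map fun ω => (Y ω, S ω)).prod (noiseLaw p r)) := by
    rw [← hlaw]
    exact (integrable_map_measure hcont.aestronglyMeasurable hae).2 hint
  have hleft := hint2.integral_prod_left
  constructor
  · exact hleft.comp_measurable hYS'
  · have e1 : ∫ ω, W (Y ω + S ω (Z ω)) ∂P
        = ∫ q, W (q.1.1 + q.1.2 q.2) ∂(P.map fun ω => ((Y ω, S ω), Z ω)) :=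
      (integral_map hae hcont.aestronglyMeasurable).symm
    rw [e1, hlaw, integral_prod _ hint2]
    exact integral_map hYS'.aemeasurable hleft.1

/-! ### The time mesh. -/

theorem coe_timeStep_nonneg (T : ℝ≥0) (N : ℕ) : 0 ≤ (timeStep T N : ℝ) := NNReal.coe_nonneg _

theorem meshTime_le (T : ℝ≥0) {N i : ℕ} (hi : i ≤ N) : meshTime T N i ≤ T := by
  rcases Nat.eq_zero_or_pos N with rfl | hN
  · simp [meshTime, timeStep]
  · have hN' : (0 : ℝ≥0) < N := by exact_mod_cast hN
    rw [meshTime, timeStep, mul_div_assoc', div_le_iff₀ hN', mul_comm]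
    gcongr

theorem meshTime_mem (T : ℝ≥0) {N i : ℕ} (hi : i ≤ N) : meshTime T N i ∈ Icc 0 T :=
  ⟨zero_le, meshTime_le T hi⟩

theorem meshTime_mono (T : ℝ≥0) (N : ℕ) : Monotone (meshTime T N) := fun i j hij => by
  unfold meshTime
  gcongr

theorem meshTime_succ (T : ℝ≥0) (N i : ℕ) :
    meshTime T N (i + 1) = meshTime T N i + timeStep T N := by
  unfold meshTime
  push_cast
  ring

theorem mul_timeStep (T : ℝ≥0) {N : ℕ} (hN : 1 ≤ N) : (N : ℝ) * (timeStep T N : ℝ) = T := by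
  have : (N : ℝ) ≠ 0 := by positivity
  rw [timeStep]
  push_cast
  field_simp

/-! ### Lipschitz and growth bounds for the coefficients. -/

section Coefficients

variable {𝔸 : Type*} [MetricSpace 𝔸] {Q : ControlProblem d p 𝔸} {T : ℝ≥0} {C₀ L : ℝ}

theorem ControlProblem.Assumptions.norm_sub_le (hQ : Q.Assumptions T C₀ L) {t : ℝ≥0}
    (ht : t ∈ Icc 0 T) {a : 𝔸} (ha : a ∈ Q.A) (x y : E d) :
    ‖Q.μ t x a - Q.μ t y a‖ ≤ C₀ * ‖x - y‖ ∧ ‖Q.σ t x a - Q.σ t y a‖ ≤ C₀ * ‖x - y‖ := by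
  have h := hQ.coeff_bound t ht t ht x y a ha
  simp only [sub_self, abs_zero, Real.sqrt_zero, add_zero] at h
  exact ⟨by linarith [norm_nonneg (Q.σ t x a - Q.σ t y a)],
    by linarith [norm_nonneg (Q.μ t x a - Q.μ t y a)]⟩

/-- Compactness of `A` bounds the coefficients at `x = 0`, and the Lipschitz bound does the rest.
The constant `M` depends on `Q`, but it serves only finiteness and integrability and never enters
the final constants. -/
theorem ControlProblem.Assumptions.exists_growth (hQ : Q.Assumptions T C₀ L) {t : ℝ≥0}
    (ht : t ∈ Icc 0 T) :
    ∃ M : ℝ, 0 ≤ M ∧ ∀ a ∈ Q.A, ∀ x : E d,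
      ‖Q.μ t x a‖ ≤ M + C₀ * ‖x‖ ∧ ‖Q.σ t x a‖ ≤ M + C₀ * ‖x‖ := by
  have hmap : MapsTo (fun a : 𝔸 => (t, (0 : E d), a)) Q.A (Icc 0 T ×ˢ univ ×ˢ Q.A) :=
    fun a ha => ⟨ht, mem_univ _, ha⟩
  have hc : ContinuousOn (fun a : 𝔸 => (t, (0 : E d), a)) Q.A := by fun_prop
  obtain ⟨M₁, h₁⟩ := hQ.isCompact.exists_bound_of_continuousOn (hQ.continuousOn_μ.comp hc hmap)
  obtain ⟨M₂, h₂⟩ := hQ.isCompact.exists_bound_of_continuousOn (hQ.continuousOn_σ.comp hc hmap)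
  refine ⟨max 0 (max M₁ M₂), le_max_left _ _, fun a ha x => ?_⟩
  obtain ⟨hμ, hσ⟩ := hQ.norm_sub_le ht ha x 0
  rw [sub_zero] at hμ hσ
  have e₁ := norm_le_norm_add_norm_sub' (Q.μ t x a) (Q.μ t 0 a)
  have e₂ := norm_le_norm_add_norm_sub' (Q.σ t x a) (Q.σ t 0 a)
  have b₁ := h₁ a ha
  have b₂ := h₂ a ha
  simp only [Function.comp_apply] at b₁ b₂
  have c₁ : M₁ ≤ max 0 (max M₁ M₂) := by simp
  have c₂ : M₂ ≤ max 0 (max M₁ M₂) := by simp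
  exact ⟨by linarith, by linarith⟩

end Coefficients

/-- The exponential rate of growth of Lipschitz constants under the Euler scheme. -/
def lipRate (p : ℕ) (C₀ : ℝ) : ℝ := C₀ + C₀ ^ 2 * p / 2

theorem lipRate_nonneg (p : ℕ) {C₀ : ℝ} (hC₀ : 0 ≤ C₀) : 0 ≤ lipRate p C₀ := by
  unfold lipRate
  positivity

/-- Here `a` and `b` stand for the differences of the means and of the diffusion coefficients after
one step from points at distance `u`. Squared, the growth factor is `(1 + C₀ h)² + C₀² p h ≤ exp ((2
C₀ + C₀² p) h)`; the square root halves the rate to `lipRate`. -/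
theorem sqrt_step_le (p : ℕ) {C₀ h u a b : ℝ} (hC₀ : 0 ≤ C₀) (hh : 0 ≤ h) (hu : 0 ≤ u)
    (ha₀ : 0 ≤ a) (hb₀ : 0 ≤ b) (ha : a ≤ (1 + C₀ * h) * u) (hb : b ≤ C₀ * u) :
    Real.sqrt (a ^ 2 + b ^ 2 * (p * h)) ≤ Real.exp (lipRate p C₀ * h) * u := by
  refine Real.sqrt_le_iff.2 ⟨by positivity, ?_⟩
  have h1 : a ^ 2 ≤ ((1 + C₀ * h) * u) ^ 2 := pow_le_pow_left₀ ha₀ ha 2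
  have h2 : b ^ 2 ≤ (C₀ * u) ^ 2 := pow_le_pow_left₀ hb₀ hb 2
  have h3 : (1 + C₀ * h) ^ 2 + C₀ ^ 2 * (p * h) ≤ Real.exp (lipRate p C₀ * h) ^ 2 := by
    have e1 : 1 + C₀ * h ≤ Real.exp (C₀ * h) := by linarith [Real.add_one_le_exp (C₀ * h)]
    have e2 : 1 + C₀ ^ 2 * (p * h) ≤ Real.exp (C₀ ^ 2 * (p * h)) := by
      linarith [Real.add_one_le_exp (C₀ ^ 2 * (p * h))]
    have e3 : Real.exp (lipRate p C₀ * h) ^ 2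
        = Real.exp (C₀ * h) ^ 2 * Real.exp (C₀ ^ 2 * (p * h)) := by
      rw [← Real.exp_nat_mul, ← Real.exp_nat_mul, ← Real.exp_add, lipRate]
      congr 1
      push_cast
      ring
    have e4 : 0 ≤ C₀ * h := by positivity
    have e5 : 0 ≤ C₀ ^ 2 * (p * h) := by positivity
    rw [e3]
    calc _ ≤ (1 + C₀ * h) ^ 2 * (1 + C₀ ^ 2 * (p * h)) := by
          nlinarith [mul_nonneg e4 e5, mul_nonneg (mul_nonneg e4 e4) e5]
      _ ≤ _ := by gcongr
  calc a ^ 2 + b ^ 2 * (p * h) ≤ ((1 + C₀ * h) * u) ^ 2 + (C₀ * u) ^ 2 * (p * h) := by gcongr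
    _ = ((1 + C₀ * h) ^ 2 + C₀ ^ 2 * (p * h)) * u ^ 2 := by ring
    _ ≤ _ := by rw [mul_pow]; gcongr

/-- The set of admissible pairs of a control value and a perturbation value. -/
abbrev Choice {𝔸 : Type*} (Q : ControlProblem d p 𝔸) (ε : ℝ) : Type _ :=
  Q.A × Metric.closedBall (0 : E d) ε

theorem Choice.norm_le {𝔸 : Type*} {Q : ControlProblem d p 𝔸} {ε : ℝ} (q : Choice Q ε) :
    ‖(q.2 : E d)‖ ≤ ε := by
  exact mem_closedBall_zero_iff.1 q.2.2

/-! ### The dynamic programming recursion and its Lipschitz bounds. -/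

section OneStep

variable {𝔸 : Type*} [MetricSpace 𝔸] {Q : ControlProblem d p 𝔸} {T : ℝ≥0} {C₀ L : ℝ}

/-- The expectation of `W` after one perturbed Euler step from `x` at time `t_i`, with control value
`a` and perturbation `e`. -/
def oneStep (Q : ControlProblem d p 𝔸) (T : ℝ≥0) (N i : ℕ) (W : E d → ℝ) (x e : E d) (a : 𝔸) : ℝ :=
  stepMean (timeStep T N) W (x + (timeStep T N : ℝ) • Q.μ (meshTime T N i) (x + e) a)
    (Q.σ (meshTime T N i) (x + e) a)

/-- The common perturbation cancels in `(x + e) - (y + e)`, so the bound is uniform in `a` and `e`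
and survives the supremum over them. -/
theorem abs_oneStep_sub_le (hQ : Q.Assumptions T C₀ L) (hC₀ : 0 ≤ C₀) {N i : ℕ} (hi : i ≤ N)
    {W : E d → ℝ} {K : ℝ} (hK : 0 ≤ K) (hW : ∀ x y, |W x - W y| ≤ K * ‖x - y‖) {a : 𝔸}
    (ha : a ∈ Q.A) (e x y : E d) :
    |oneStep Q T N i W x e a - oneStep Q T N i W y e a|
      ≤ K * Real.exp (lipRate p C₀ * timeStep T N) * ‖x - y‖ := by
  refine (abs_stepMean_sub_le (coe_timeStep_nonneg T N) hK hW _ _ _ _).trans ?_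
  rw [mul_assoc]
  refine mul_le_mul_of_nonneg_left ?_ hK
  obtain ⟨hμ, hσ⟩ := hQ.norm_sub_le (meshTime_mem T hi) ha (x + e) (y + e)
  rw [add_sub_add_right_eq_sub] at hμ hσ
  refine sqrt_step_le p hC₀ (coe_timeStep_nonneg T N) (norm_nonneg _) (norm_nonneg _)
    (norm_nonneg _) ?_ hσ
  rw [add_sub_add_comm, ← smul_sub]
  refine (norm_add_le _ _).trans ?_
  rw [norm_smul, Real.norm_of_nonneg (coe_timeStep_nonneg T N)]
  nlinarith [mul_le_mul_of_nonneg_left hμ (coe_timeStep_nonneg T N)]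

/-- Comparison with the trivial step `m = 0`, `s = 0`, whose mean is `W 0`. This makes the supremum
in `dpStep` a genuine one. -/
theorem exists_abs_oneStep_le (hQ : Q.Assumptions T C₀ L) (hC₀ : 0 ≤ C₀) {N i : ℕ} (hi : i ≤ N)
    {W : E d → ℝ} {K : ℝ} (hK : 0 ≤ K) (hW : ∀ x y, |W x - W y| ≤ K * ‖x - y‖) (ε : ℝ) (x : E d) :
    ∃ M, ∀ a ∈ Q.A, ∀ e : E d, ‖e‖ ≤ ε → |oneStep Q T N i W x e a| ≤ M := by
  obtain ⟨M, hM, hg⟩ := hQ.exists_growth (meshTime_mem T hi)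
  set h : ℝ := (timeStep T N : ℝ)
  have hh : 0 ≤ h := coe_timeStep_nonneg T N
  set G := M + C₀ * (‖x‖ + ε)
  refine ⟨|W 0| + K * Real.sqrt ((‖x‖ + h * G) ^ 2 + G ^ 2 * (p * h)), fun a ha e he => ?_⟩
  obtain ⟨hμ, hσ⟩ := hg a ha (x + e)
  have hxe : M + C₀ * ‖x + e‖ ≤ G := by
    have : ‖x + e‖ ≤ ‖x‖ + ε := (norm_add_le x e).trans (by gcongr)
    simp only [G]
    gcongr
  have hmain := abs_stepMean_sub_le (p := p) hh hK hW
    (x + h • Q.μ (meshTime T N i) (x + e) a) 0 (Q.σ (meshTime T N i) (x + e) a) 0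
  rw [stepMean_zero_zero, sub_zero, sub_zero] at hmain
  have h2 : ‖x + h • Q.μ (meshTime T N i) (x + e) a‖ ≤ ‖x‖ + h * G := by
    refine (norm_add_le _ _).trans ?_
    rw [norm_smul, Real.norm_of_nonneg hh]
    gcongr
    linarith
  have h3 : K * Real.sqrt (‖x + h • Q.μ (meshTime T N i) (x + e) a‖ ^ 2
      + ‖Q.σ (meshTime T N i) (x + e) a‖ ^ 2 * (p * h))
      ≤ K * Real.sqrt ((‖x‖ + h * G) ^ 2 + G ^ 2 * (p * h)) := by
    gcongr
    linarith
  have h4 := abs_sub_abs_le_abs_sub (oneStep Q T N i W x e a) (W 0)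
  have h5 : |oneStep Q T N i W x e a - W 0| ≤ _ := hmain
  linarith

theorem ControlProblem.Assumptions.nonempty_choice (hQ : Q.Assumptions T C₀ L) {ε : ℝ}
    (hε : 0 < ε) : Nonempty (Choice Q ε) :=
  ⟨⟨hQ.nonempty.some, hQ.nonempty.some_mem⟩, ⟨0, by simpa using hε.le⟩⟩

/-- Dynamic programming operator at the mesh point `t_i`. -/
def dpStep (Q : ControlProblem d p 𝔸) (T : ℝ≥0) (N : ℕ) (ε : ℝ) (i : ℕ) (W : E d → ℝ)
    (x : E d) : ℝ :=
  ⨆ q : Choice Q ε, oneStep Q T N i W x q.2 q.1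

theorem bddAbove_oneStep (hQ : Q.Assumptions T C₀ L) (hC₀ : 0 ≤ C₀) {N i : ℕ} (hi : i ≤ N)
    {W : E d → ℝ} {K : ℝ} (hK : 0 ≤ K) (hW : ∀ x y, |W x - W y| ≤ K * ‖x - y‖) (ε : ℝ) (x : E d) :
    BddAbove (range fun q : Choice Q ε => oneStep Q T N i W x q.2 q.1) := by
  obtain ⟨M, hM⟩ := exists_abs_oneStep_le hQ hC₀ hi hK hW ε x
  refine ⟨M, ?_⟩
  rintro _ ⟨q, rfl⟩
  exact (le_abs_self _).trans (hM _ q.1.2 _ q.norm_le)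

theorem oneStep_le_dpStep (hQ : Q.Assumptions T C₀ L) (hC₀ : 0 ≤ C₀) {N i : ℕ} (hi : i ≤ N)
    {W : E d → ℝ} {K : ℝ} (hK : 0 ≤ K) (hW : ∀ x y, |W x - W y| ≤ K * ‖x - y‖) {ε : ℝ} {a : 𝔸}
    (ha : a ∈ Q.A) {e : E d} (he : ‖e‖ ≤ ε) (x : E d) :
    oneStep Q T N i W x e a ≤ dpStep Q T N ε i W x :=
  le_ciSup (bddAbove_oneStep hQ hC₀ hi hK hW ε x)
    ((⟨a, ha⟩, ⟨e, by simpa using he⟩) : Choice Q ε)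

theorem abs_dpStep_sub_le (hQ : Q.Assumptions T C₀ L) (hC₀ : 0 ≤ C₀) {N i : ℕ} (hi : i ≤ N)
    {W : E d → ℝ} {K : ℝ} (hK : 0 ≤ K) (hW : ∀ x y, |W x - W y| ≤ K * ‖x - y‖) {ε : ℝ}
    (hε : 0 < ε) (x y : E d) :
    |dpStep Q T N ε i W x - dpStep Q T N ε i W y|
      ≤ K * Real.exp (lipRate p C₀ * timeStep T N) * ‖x - y‖ := by
  have := hQ.nonempty_choice hε
  have key : ∀ x y : E d, dpStep Q T N ε i W x
      ≤ dpStep Q T N ε i W y + K * Real.exp (lipRate p C₀ * timeStep T N) * ‖x - y‖ := by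
    intro x y
    refine ciSup_le fun q => ?_
    have h1 := (abs_le.1 (abs_oneStep_sub_le hQ hC₀ hi hK hW q.1.2 q.2 x y)).2
    have h2 := oneStep_le_dpStep hQ hC₀ hi hK hW q.1.2 q.norm_le y
    linarith
  have h1 := key x y
  have h2 := key y x
  rw [norm_sub_rev] at h2
  exact abs_le.2 ⟨by linarith, by linarith⟩

/-- The dynamic programming value with `k` steps remaining. -/
def dpValue (Q : ControlProblem d p 𝔸) (T : ℝ≥0) (N : ℕ) (ε : ℝ) : ℕ → E d → ℝ
  | 0 => Q.ψ
  | k + 1 => dpStep Q T N ε (N - (k + 1)) (dpValue Q T N ε k)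

theorem abs_dpValue_sub_le_exp (hQ : Q.Assumptions T C₀ L) (hC₀ : 0 ≤ C₀) (N : ℕ) {ε : ℝ}
    (hε : 0 < ε) (k : ℕ) (x y : E d) :
    |dpValue Q T N ε k x - dpValue Q T N ε k y|
      ≤ L * Real.exp (lipRate p C₀ * (k * timeStep T N)) * ‖x - y‖ := by
  induction k generalizing x y with
  | zero => simpa [dpValue] using hQ.cost_bound x y
  | succ k ih =>
    have hL := hQ.L_nonneg
    refine (abs_dpStep_sub_le hQ hC₀ (Nat.sub_le _ _) (by positivity) ih hε x y).trans_eq ?_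
    rw [mul_assoc L, ← Real.exp_add]
    congr 3
    push_cast
    ring

/-- The Lipschitz constant of the value functions, per unit of the Lipschitz constant of `ψ`. -/
def lipConst (p : ℕ) (T : ℝ≥0) (C₀ : ℝ) : ℝ := Real.exp (lipRate p C₀ * T)

theorem lipConst_nonneg (p : ℕ) (T : ℝ≥0) (C₀ : ℝ) : 0 ≤ lipConst p T C₀ := (Real.exp_pos _).le

/-- The accumulated exponent is harmless because `k h ≤ N h = T`. -/
theorem abs_dpValue_sub_le (hQ : Q.Assumptions T C₀ L) (hC₀ : 0 ≤ C₀) {N : ℕ} (hN : 1 ≤ N) {ε : ℝ}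
    (hε : 0 < ε) {k : ℕ} (hk : k ≤ N) (x y : E d) :
    |dpValue Q T N ε k x - dpValue Q T N ε k y| ≤ L * lipConst p T C₀ * ‖x - y‖ := by
  refine (abs_dpValue_sub_le_exp hQ hC₀ N hε k x y).trans ?_
  have hL := hQ.L_nonneg
  have hr := lipRate_nonneg p hC₀
  have : (k : ℝ) * (timeStep T N : ℝ) ≤ T := by
    rw [← mul_timeStep T hN]
    gcongr
  unfold lipConst
  gcongr

end OneStep

/-! ### Measurability and integrability of the Euler chain. -/

theorem stronglyMeasurable_comp_of_continuousOn {X 𝔸 β Ω : Type*} [TopologicalSpace X]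
    [MetricSpace 𝔸] [TopologicalSpace β] {m : MeasurableSpace Ω} {A : Set 𝔸} (hA : IsCompact A)
    {f : X → 𝔸 → β} (hf : ContinuousOn (fun q : X × 𝔸 => f q.1 q.2) (univ ×ˢ A)) {x : Ω → X}
    (hx : StronglyMeasurable x) {α : Ω → 𝔸} (hα : StronglyMeasurable α) (hαA : ∀ ω, α ω ∈ A) :
    StronglyMeasurable fun ω => f (x ω) (α ω) := by
  borelize 𝔸
  -- Continuity is known only over `A`, so `α` is regarded as a map into the subtype; compactness
  -- makes that subtype second countable, and measurable maps into it are strongly measurable.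
  have : CompactSpace A := isCompact_iff_compactSpace.1 hA
  have hα' : StronglyMeasurable fun ω => (⟨α ω, hαA ω⟩ : A) :=
    hα.measurable.subtype_mk.stronglyMeasurable
  have hc : Continuous fun q : X × A => f q.1 q.2 :=
    hf.comp_continuous (f := fun q : X × A => (q.1, (q.2 : 𝔸))) (by fun_prop)
      fun q => ⟨mem_univ _, q.2.2⟩
  exact hc.comp_stronglyMeasurable (hx.prodMk hα')

section ChainEquations

variable {𝔸 Ω : Type*} {Q : ControlProblem d p 𝔸} {T : ℝ≥0} {B : ℝ≥0 → Ω → E p}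
  {α : ℝ≥0 → Ω → 𝔸} {e : ℝ≥0 → Ω → E d} {N n : ℕ}

/-- One perturbed Euler step from the random point `X` at time `t_i`. -/
def eulerStep (Q : ControlProblem d p 𝔸) (T : ℝ≥0) (N : ℕ) (B : ℝ≥0 → Ω → E p) (i : ℕ)
    (X e : Ω → E d) (α : Ω → 𝔸) (ω : Ω) : E d :=
  X ω + (timeStep T N : ℝ) • Q.μ (meshTime T N i) (X ω + e ω) (α ω)
    + Q.σ (meshTime T N i) (X ω + e ω) (α ω) (B (meshTime T N (i + 1)) ω - B (meshTime T N i) ω)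

theorem perturbedEuler_of_le (x : E d) {i : ℕ} (hi : i ≤ n) :
    perturbedEuler Q T N B α e n x i = fun _ => x := by
  cases i with
  | zero => rfl
  | succ i =>
    funext ω
    simp only [perturbedEuler]
    rw [if_neg (by omega)]

theorem perturbedEuler_succ (x : E d) {i : ℕ} (hi : n ≤ i) :
    perturbedEuler Q T N B α e n x (i + 1)
      = eulerStep Q T N B i (perturbedEuler Q T N B α e n x i) (e (meshTime T N i))
        (α (meshTime T N i)) := by
  funext ω
  simp only [perturbedEuler]
  rw [if_pos hi]
  rfl

end ChainEquations

section Step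

variable {𝔸 Ω : Type*} [MetricSpace 𝔸] {Q : ControlProblem d p 𝔸} {T : ℝ≥0} {C₀ L : ℝ}
  {mΩ : MeasurableSpace Ω} {P : Measure Ω} {𝓕 : Filtration ℝ≥0 mΩ} {B : ℝ≥0 → Ω → E p}

theorem IsBrownianMotion.hasLaw_increment (hB : IsBrownianMotion B 𝓕 P) (N i : ℕ) :
    HasLaw (fun ω => B (meshTime T N (i + 1)) ω - B (meshTime T N i) ω)
      (noiseLaw p (timeStep T N)) P := by
  have h := hB.law _ _ (meshTime_mono T N (Nat.le_succ i))
  have e : ((meshTime T N (i + 1) : ℝ≥0) : ℝ) - (meshTime T N i : ℝ) = timeStep T N := by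
    rw [meshTime_succ]
    push_cast
    ring
  rw [Nat.succ_eq_add_one, e] at h
  exact h

theorem ControlProblem.Assumptions.stronglyMeasurable_coeff (hQ : Q.Assumptions T C₀ L) {t : ℝ≥0}
    (ht : t ∈ Icc 0 T) {m : MeasurableSpace Ω} {X : Ω → E d} (hX : StronglyMeasurable X)
    {α : Ω → 𝔸} (hα : StronglyMeasurable α) (hαA : ∀ ω, α ω ∈ Q.A) :
    (StronglyMeasurable fun ω => Q.μ t (X ω) (α ω)) ∧
      StronglyMeasurable fun ω => Q.σ t (X ω) (α ω) := by
  have hc : Continuous fun q : E d × 𝔸 => (t, q.1, q.2) := by fun_prop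
  have hmap : MapsTo (fun q : E d × 𝔸 => (t, q.1, q.2)) (univ ×ˢ Q.A)
      (Icc 0 T ×ˢ univ ×ˢ Q.A) := fun q hq => ⟨ht, mem_univ _, hq.2⟩
  exact ⟨stronglyMeasurable_comp_of_continuousOn hQ.isCompact
      (hQ.continuousOn_μ.comp hc.continuousOn hmap) hX hα hαA,
    stronglyMeasurable_comp_of_continuousOn hQ.isCompact
      (hQ.continuousOn_σ.comp hc.continuousOn hmap) hX hα hαA⟩

variable {N i : ℕ} {X e : Ω → E d} {α : Ω → 𝔸} {ε : ℝ}

theorem stronglyMeasurable_eulerStep (hQ : Q.Assumptions T C₀ L) (hB : IsBrownianMotion B 𝓕 P)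
    (hi : i ≤ N)
    (hX : StronglyMeasurable[𝓕 (meshTime T N i)] X) (he : StronglyMeasurable[𝓕 (meshTime T N i)] e)
    (hα : StronglyMeasurable[𝓕 (meshTime T N i)] α) (hαA : ∀ ω, α ω ∈ Q.A) :
    StronglyMeasurable[𝓕 (meshTime T N (i + 1))] (eulerStep Q T N B i X e α) := by
  have hle := 𝓕.mono (meshTime_mono T N (Nat.le_succ i))
  have hXe : StronglyMeasurable[𝓕 (meshTime T N i)] fun ω => X ω + e ω := hX.add he
  obtain ⟨hμ, hσ⟩ := hQ.stronglyMeasurable_coeff (meshTime_mem T hi) hXe hα hαA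
  have hΔ := (hB.adapted (meshTime T N (i + 1))).sub ((hB.adapted (meshTime T N i)).mono hle)
  have hY : StronglyMeasurable[𝓕 (meshTime T N (i + 1))] fun ω =>
      X ω + (timeStep T N : ℝ) • Q.μ (meshTime T N i) (X ω + e ω) (α ω) :=
    (hX.add (hμ.const_smul (timeStep T N : ℝ))).mono hle
  have hS : StronglyMeasurable[𝓕 (meshTime T N (i + 1))] fun ω =>
      Q.σ (meshTime T N i) (X ω + e ω) (α ω)
        (B (meshTime T N (i + 1)) ω - B (meshTime T N i) ω) := by
    have hc : Continuous fun q : (E p →L[ℝ] E d) × E p => q.1 q.2 := by fun_prop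
    exact hc.comp_stronglyMeasurable ((hσ.mono hle).prodMk hΔ)
  exact hY.add hS

/-- The delicate term is `σ ΔB`: a first moment of each factor suffices, because `σ` is known at
time `t_i` and hence independent of the increment. -/
theorem integrable_eulerStep [IsProbabilityMeasure P] (hQ : Q.Assumptions T C₀ L) (hC₀ : 0 ≤ C₀)
    (hB : IsBrownianMotion B 𝓕 P) (hi : i ≤ N)
    (hX : StronglyMeasurable[𝓕 (meshTime T N i)] X) (he : StronglyMeasurable[𝓕 (meshTime T N i)] e)
    (hα : StronglyMeasurable[𝓕 (meshTime T N i)] α) (hαA : ∀ ω, α ω ∈ Q.A)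
    (heε : ∀ ω, ‖e ω‖ ≤ ε) (hXi : Integrable X P) :
    Integrable (eulerStep Q T N B i X e α) P := by
  obtain ⟨M, hM, hg⟩ := hQ.exists_growth (meshTime_mem T hi)
  have hXe : StronglyMeasurable[𝓕 (meshTime T N i)] fun ω => X ω + e ω := hX.add he
  obtain ⟨hμ, hσ⟩ := hQ.stronglyMeasurable_coeff (meshTime_mem T hi) hXe hα hαA
  have hm := 𝓕.le (meshTime T N i)
  have hbound : Integrable (fun ω => M + C₀ * (‖X ω‖ + ε)) P :=
    (integrable_const M).add ((hXi.norm.add (integrable_const ε)).const_mul C₀)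
  have hnorm : ∀ ω, M + C₀ * ‖X ω + e ω‖ ≤ M + C₀ * (‖X ω‖ + ε) := fun ω => by
    have : ‖X ω + e ω‖ ≤ ‖X ω‖ + ε := (norm_add_le _ _).trans (by gcongr; exact heε ω)
    gcongr
  have hμi : Integrable (fun ω => Q.μ (meshTime T N i) (X ω + e ω) (α ω)) P :=
    hbound.mono' (hμ.mono hm).aestronglyMeasurable
      (ae_of_all _ fun ω => ((hg _ (hαA ω) _).1).trans (hnorm ω))
  have hσi : Integrable (fun ω => Q.σ (meshTime T N i) (X ω + e ω) (α ω)) P :=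
    hbound.mono' (hσ.mono hm).aestronglyMeasurable
      (ae_of_all _ fun ω => ((hg _ (hαA ω) _).2).trans (hnorm ω))
  have hlaw := hB.hasLaw_increment (T := T) N i
  have hΔi : Integrable (fun ω => B (meshTime T N (i + 1)) ω - B (meshTime T N i) ω) P := by
    have := integrable_noiseLaw (p := p) (timeStep T N : ℝ)
    rw [← hlaw.map_eq] at this
    exact this.comp_aemeasurable hlaw.aemeasurable
  have hind : IndepFun (fun ω => ‖Q.σ (meshTime T N i) (X ω + e ω) (α ω)‖)
      (fun ω => ‖B (meshTime T N (i + 1)) ω - B (meshTime T N i) ω‖) P := by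
    have h0 := (hB.indep _ _ (meshTime_mono T N (Nat.le_succ i))).symm
    have h1 : IndepFun (fun ω => Q.σ (meshTime T N i) (X ω + e ω) (α ω))
        (fun ω => B (meshTime T N (i + 1)) ω - B (meshTime T N i) ω) P := by
      rw [IndepFun_iff_Indep]
      exact indep_of_indep_of_le_left h0 hσ.measurable.comap_le
    exact h1.comp measurable_norm measurable_norm
  have hc : Continuous fun q : (E p →L[ℝ] E d) × E p => q.1 q.2 := by fun_prop
  have hprod : Integrable (fun ω => ‖Q.σ (meshTime T N i) (X ω + e ω) (α ω)‖
      * ‖B (meshTime T N (i + 1)) ω - B (meshTime T N i) ω‖) P :=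
    hind.integrable_mul hσi.norm hΔi.norm
  have hY : Integrable (fun ω =>
      X ω + (timeStep T N : ℝ) • Q.μ (meshTime T N i) (X ω + e ω) (α ω)) P :=
    hXi.add (hμi.smul (timeStep T N : ℝ))
  have hS : Integrable (fun ω => Q.σ (meshTime T N i) (X ω + e ω) (α ω)
      (B (meshTime T N (i + 1)) ω - B (meshTime T N i) ω)) P :=
    hprod.mono' (hc.comp_aestronglyMeasurable (hσi.1.prodMk hΔi.1))
      (ae_of_all _ fun ω => ContinuousLinearMap.le_opNorm _ _)
  exact hY.add hS

theorem integral_comp_eulerStep [IsProbabilityMeasure P] (hQ : Q.Assumptions T C₀ L) (hC₀ : 0 ≤ C₀)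
    (hB : IsBrownianMotion B 𝓕 P) (hi : i ≤ N)
    (hX : StronglyMeasurable[𝓕 (meshTime T N i)] X) (he : StronglyMeasurable[𝓕 (meshTime T N i)] e)
    (hα : StronglyMeasurable[𝓕 (meshTime T N i)] α) (hαA : ∀ ω, α ω ∈ Q.A)
    (heε : ∀ ω, ‖e ω‖ ≤ ε) (hXi : Integrable X P) {W : E d → ℝ} {K : ℝ}
    (hW : ∀ x y, |W x - W y| ≤ K * ‖x - y‖) :
    Integrable (fun ω => oneStep Q T N i W (X ω) (e ω) (α ω)) P ∧
    ∫ ω, W (eulerStep Q T N B i X e α ω) ∂P = ∫ ω, oneStep Q T N i W (X ω) (e ω) (α ω) ∂P := by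
  have hXe : StronglyMeasurable[𝓕 (meshTime T N i)] fun ω => X ω + e ω := hX.add he
  obtain ⟨hμ, hσ⟩ := hQ.stronglyMeasurable_coeff (meshTime_mem T hi) hXe hα hαA
  have hY : StronglyMeasurable[𝓕 (meshTime T N i)] fun ω =>
      X ω + (timeStep T N : ℝ) • Q.μ (meshTime T N i) (X ω + e ω) (α ω) :=
    hX.add (hμ.const_smul (timeStep T N : ℝ))
  exact integral_comp_eq_integral_stepMean (𝓕.le (meshTime T N i)) (hB.hasLaw_increment N i)
    (hB.indep _ _ (meshTime_mono T N (Nat.le_succ i))) hY.measurable hσ.measurable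
    (continuous_of_abs_sub_le hW)
    (integrable_comp_of_abs_sub_le hW
      (integrable_eulerStep hQ hC₀ hB hi hX he hα hαA heε hXi))

end Step

/-! ### Upper bound: no admissible pair beats the recursion. -/

section Chain

variable {𝔸 Ω : Type*} [MetricSpace 𝔸] {Q : ControlProblem d p 𝔸} {T : ℝ≥0} {C₀ L : ℝ}
  {mΩ : MeasurableSpace Ω} {P : Measure Ω} {𝓕 : Filtration ℝ≥0 mΩ} {B : ℝ≥0 → Ω → E p}
  {α : ℝ≥0 → Ω → 𝔸} {e : ℝ≥0 → Ω → E d} {N n : ℕ} {ε : ℝ}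

theorem perturbedEuler_spec [IsProbabilityMeasure P] (hQ : Q.Assumptions T C₀ L) (hC₀ : 0 ≤ C₀)
    (hB : IsBrownianMotion B 𝓕 P) (hα : α ∈ controls Q.A T N 𝓕) (he : e ∈ perturbations d ε T N 𝓕)
    (x : E d) (i : ℕ) (hi : i ≤ N) :
    StronglyMeasurable[𝓕 (meshTime T N i)] (perturbedEuler Q T N B α e n x i) ∧
      Integrable (perturbedEuler Q T N B α e n x i) P := by
  induction i with
  | zero => exact ⟨stronglyMeasurable_const, integrable_const x⟩
  | succ i ih =>
    rcases le_or_gt n i with hni | hni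
    · obtain ⟨h1, h2⟩ := ih (by omega)
      rw [perturbedEuler_succ x hni]
      have hα' := hα.1.stronglyAdapted (meshTime T N i)
      have he' := he.1.stronglyAdapted (meshTime T N i)
      exact ⟨stronglyMeasurable_eulerStep hQ hB (by omega) h1 he' hα' (hα.2.1 _),
        integrable_eulerStep hQ hC₀ hB (by omega) h1 he' hα' (hα.2.1 _) (he.2.1 _) h2⟩
    · rw [perturbedEuler_of_le x (by omega : i + 1 ≤ n)]
      exact ⟨stronglyMeasurable_const, integrable_const x⟩

theorem integrable_cost [IsProbabilityMeasure P] (hQ : Q.Assumptions T C₀ L) (hC₀ : 0 ≤ C₀)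
    (hB : IsBrownianMotion B 𝓕 P) (hα : α ∈ controls Q.A T N 𝓕) (he : e ∈ perturbations d ε T N 𝓕)
    (x : E d) : Integrable (fun ω => Q.ψ (perturbedEuler Q T N B α e n x N ω)) P :=
  integrable_comp_of_abs_sub_le hQ.cost_bound (perturbedEuler_spec hQ hC₀ hB hα he x N le_rfl).2

/-- After freezing the past, the control and perturbation values at `ω` are one competitor in the
supremum defining `dpStep`. -/
theorem integral_dpValue_eulerStep_le [IsProbabilityMeasure P] (hQ : Q.Assumptions T C₀ L)
    (hC₀ : 0 ≤ C₀) (hB : IsBrownianMotion B 𝓕 P) (hε : 0 < ε) {k : ℕ} (hk : k < N)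
    (hα : α ∈ controls Q.A T N 𝓕) (he : e ∈ perturbations d ε T N 𝓕) (x : E d)
    (hn : n + (k + 1) ≤ N) :
    ∫ ω, dpValue Q T N ε k (perturbedEuler Q T N B α e n x (N - k) ω) ∂P
      ≤ ∫ ω, dpValue Q T N ε (k + 1) (perturbedEuler Q T N B α e n x (N - (k + 1)) ω) ∂P := by
  have hL := hQ.L_nonneg
  have hN : 1 ≤ N := by omega
  have hLip := fun x y : E d => abs_dpValue_sub_le hQ hC₀ hN hε hk.le x y
  have hK : 0 ≤ L * lipConst p T C₀ := mul_nonneg hL (lipConst_nonneg p T C₀)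
  have hi : N - (k + 1) ≤ N := Nat.sub_le _ _
  obtain ⟨h1, h2⟩ := perturbedEuler_spec (n := n) hQ hC₀ hB hα he x (N - (k + 1)) hi
  have hα' := hα.1.stronglyAdapted (meshTime T N (N - (k + 1)))
  have he' := he.1.stronglyAdapted (meshTime T N (N - (k + 1)))
  have hstep := perturbedEuler_succ (Q := Q) (T := T) (N := N) (B := B) (α := α) (e := e) x
    (show n ≤ N - (k + 1) by omega)
  rw [show N - (k + 1) + 1 = N - k by omega] at hstep
  obtain ⟨hint, heq⟩ :=
    integral_comp_eulerStep hQ hC₀ hB hi h1 he' hα' (hα.2.1 _) (he.2.1 _) h2 hLip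
  rw [hstep, heq]
  refine integral_mono hint
    (integrable_comp_of_abs_sub_le (abs_dpValue_sub_le hQ hC₀ hN hε (k := k + 1) hk) h2) fun ω => ?_
  exact oneStep_le_dpStep hQ hC₀ hi hK hLip (hα.2.1 _ ω) (he.2.1 _ ω) _

theorem integral_cost_le_dpValue [IsProbabilityMeasure P] (hQ : Q.Assumptions T C₀ L)
    (hC₀ : 0 ≤ C₀) (hB : IsBrownianMotion B 𝓕 P) (hε : 0 < ε) (hn : n ≤ N)
    (hα : α ∈ controls Q.A T N 𝓕) (he : e ∈ perturbations d ε T N 𝓕) (x : E d) :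
    ∫ ω, Q.ψ (perturbedEuler Q T N B α e n x N ω) ∂P ≤ dpValue Q T N ε (N - n) x := by
  have key : ∀ k, n + k ≤ N → ∫ ω, Q.ψ (perturbedEuler Q T N B α e n x N ω) ∂P
      ≤ ∫ ω, dpValue Q T N ε k (perturbedEuler Q T N B α e n x (N - k) ω) ∂P := by
    intro k
    induction k with
    | zero => exact fun _ => le_rfl
    | succ k ih =>
      exact fun hk => (ih (by omega)).trans
        (integral_dpValue_eulerStep_le hQ hC₀ hB hε (by omega) hα he x hk)
  refine (key (N - n) (by omega)).trans_eq ?_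
  -- With `k = N - n` the chain is back at its deterministic starting point.
  rw [perturbedEuler_of_le x (by omega : N - (N - n) ≤ n)]
  simp

end Chain

/-! ### Progressive measurability of piecewise constant processes. -/

section MeshIndex

/-- The index of the mesh interval that contains `s`, capped at `N`. -/
def meshIndex (T : ℝ≥0) (N : ℕ) (s : ℝ≥0) : ℕ := min N ⌊s / timeStep T N⌋₊

theorem timeStep_pos {T : ℝ≥0} (hT : 0 < T) {N : ℕ} (hN : 1 ≤ N) : 0 < timeStep T N :=
  div_pos hT (by exact_mod_cast hN)

theorem meshIndex_le (T : ℝ≥0) (N : ℕ) (s : ℝ≥0) : meshIndex T N s ≤ N := min_le_left _ _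

theorem meshIndex_mono (T : ℝ≥0) (N : ℕ) : Monotone (meshIndex T N) := fun s t hst => by
  unfold meshIndex
  gcongr

theorem measurable_meshIndex (T : ℝ≥0) (N : ℕ) : Measurable (meshIndex T N) :=
  (meshIndex_mono T N).measurable

theorem meshTime_meshIndex_le {T : ℝ≥0} (hT : 0 < T) {N : ℕ} (hN : 1 ≤ N) (s : ℝ≥0) :
    meshTime T N (meshIndex T N s) ≤ s := by
  have h := timeStep_pos hT hN
  have h1 : ((meshIndex T N s : ℕ) : ℝ≥0) ≤ s / timeStep T N :=
    (Nat.cast_le.2 (min_le_right _ _)).trans (Nat.floor_le zero_le)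
  rwa [le_div_iff₀ h] at h1

theorem meshIndex_eq {T : ℝ≥0} (hT : 0 < T) {N : ℕ} (hN : 1 ≤ N) {i : ℕ} (hi : i ≤ N) {s : ℝ≥0}
    (hs : s ∈ Ico (meshTime T N i) (meshTime T N (i + 1))) : meshIndex T N s = i := by
  have h := timeStep_pos hT hN
  have h1 : ⌊s / timeStep T N⌋₊ = i := by
    rw [Nat.floor_eq_iff zero_le, le_div_iff₀ h, div_lt_iff₀ h]
    refine ⟨hs.1, ?_⟩
    have := hs.2
    unfold meshTime at this
    exact_mod_cast this
  rw [meshIndex, h1, min_eq_right hi]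

theorem meshIndex_meshTime {T : ℝ≥0} (hT : 0 < T) {N : ℕ} (hN : 1 ≤ N) {i : ℕ} (hi : i ≤ N) :
    meshIndex T N (meshTime T N i) = i := by
  refine meshIndex_eq hT hN hi ⟨le_rfl, ?_⟩
  rw [meshTime_succ]
  exact lt_add_of_pos_right _ (timeStep_pos hT hN)

theorem isStronglyProgressive_meshIndex {Ω β : Type*} [MetricSpace β] {mΩ : MeasurableSpace Ω}
    {𝓕 : Filtration ℝ≥0 mΩ} {T : ℝ≥0} (hT : 0 < T) {N : ℕ} (hN : 1 ≤ N) {g : ℕ → Ω → β}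
    (hg : ∀ i ≤ N, StronglyMeasurable[𝓕 (meshTime T N i)] (g i)) :
    IsStronglyProgressive 𝓕 fun s ω => g (meshIndex T N s) ω := by
  intro t
  borelize β
  -- Truncating the index at `meshIndex T N t` makes every term measurable at time `t`, and changes
  -- nothing for times `s ≤ t`.
  have hg' : ∀ i, StronglyMeasurable[𝓕 t] (g (min i (meshIndex T N t))) := fun i =>
    (hg _ ((min_le_right _ _).trans (meshIndex_le T N t))).mono
      (𝓕.mono ((meshTime_mono T N (min_le_right _ _)).trans (meshTime_meshIndex_le hT hN t)))
  let _ : MeasurableSpace Ω := 𝓕 t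
  have h1 : StronglyMeasurable fun q : ℕ × Ω => g (min q.1 (meshIndex T N t)) q.2 := by
    refine stronglyMeasurable_iff_measurable_separable.2
      ⟨measurable_from_prod_countable_right fun i => (hg' i).measurable, ?_⟩
    refine (TopologicalSpace.IsSeparable.iUnion fun i => (hg' i).isSeparable_range).mono ?_
    rintro _ ⟨⟨i, ω⟩, rfl⟩
    exact mem_iUnion.2 ⟨i, ω, rfl⟩
  have h2 : Measurable fun q : Iic t × Ω => (meshIndex T N q.1, q.2) :=
    ((measurable_meshIndex T N).comp (measurable_subtype_coe.comp measurable_fst)).prodMk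
      measurable_snd
  have heq : (fun q : Iic t × Ω => g (meshIndex T N q.1) q.2)
      = (fun q : ℕ × Ω => g (min q.1 (meshIndex T N t)) q.2) ∘
        fun q : Iic t × Ω => (meshIndex T N q.1, q.2) := by
    funext q
    simp only [Function.comp_apply]
    rw [min_eq_left (meshIndex_mono T N q.1.2)]
  rw [heq]
  exact h1.comp_measurable h2

end MeshIndex

/-! ### Feedback controls. -/

section FeedbackEquations

/-- The Euler chain under feedback controls. -/
def feedbackChain {𝔸 Ω : Type*} (Q : ControlProblem d p 𝔸) (T : ℝ≥0) (N : ℕ) (B : ℝ≥0 → Ω → E p)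
    (fa : ℕ → E d → 𝔸) (fe : ℕ → E d → E d) (n : ℕ) (x : E d) : ℕ → Ω → E d
  | 0 => fun _ => x
  | i + 1 =>
      if n ≤ i then
        eulerStep Q T N B i (feedbackChain Q T N B fa fe n x i)
          (fun ω => fe i (feedbackChain Q T N B fa fe n x i ω))
          (fun ω => fa i (feedbackChain Q T N B fa fe n x i ω))
      else fun _ => x

/-- The process obtained from the feedback `f` along the feedback chain. -/
def feedbackProcess {𝔸 Ω β : Type*} (Q : ControlProblem d p 𝔸) (T : ℝ≥0) (N : ℕ)
    (B : ℝ≥0 → Ω → E p) (fa : ℕ → E d → 𝔸) (fe : ℕ → E d → E d) (n : ℕ) (x : E d)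
    (f : ℕ → E d → β) (s : ℝ≥0) (ω : Ω) : β :=
  f (meshIndex T N s) (feedbackChain Q T N B fa fe n x (meshIndex T N s) ω)

variable {𝔸 Ω : Type*} {Q : ControlProblem d p 𝔸} {T : ℝ≥0} {B : ℝ≥0 → Ω → E p} {N n : ℕ}
  {fa : ℕ → E d → 𝔸} {fe : ℕ → E d → E d}

theorem feedbackChain_succ (x : E d) {i : ℕ} (hi : n ≤ i) :
    feedbackChain Q T N B fa fe n x (i + 1)
      = eulerStep Q T N B i (feedbackChain Q T N B fa fe n x i)
          (fun ω => fe i (feedbackChain Q T N B fa fe n x i ω))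
          (fun ω => fa i (feedbackChain Q T N B fa fe n x i ω)) := by
  rw [feedbackChain, if_pos hi]

theorem isPiecewiseConstant_feedbackProcess {β : Type*} (hT : 0 < T) (hN : 1 ≤ N) (x : E d)
    (f : ℕ → E d → β) :
    IsPiecewiseConstant T N (feedbackProcess Q T N B fa fe n x f) := by
  intro ω i hi s hs
  rw [feedbackProcess, feedbackProcess, meshIndex_eq hT hN hi.le hs, meshIndex_meshTime hT hN hi.le]

/-- The controls are read off the very chain that they drive. Building `feedbackChain` first avoids
the circularity, and this identity closes the loop. -/
theorem perturbedEuler_feedbackProcess (hT : 0 < T) (hN : 1 ≤ N) (x : E d) (i : ℕ) (hi : i ≤ N) :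
    perturbedEuler Q T N B (feedbackProcess Q T N B fa fe n x fa)
      (feedbackProcess Q T N B fa fe n x fe) n x i = feedbackChain Q T N B fa fe n x i := by
  induction i with
  | zero => rfl
  | succ i ih =>
    rw [feedbackChain]
    split_ifs with hni
    · rw [perturbedEuler_succ x hni, ih (by omega)]
      unfold feedbackProcess
      rw [meshIndex_meshTime hT hN (by omega)]
    · exact perturbedEuler_of_le x (by omega)

end FeedbackEquations

/-! ### Lower bound by almost optimal feedback, and the dynamic programming principle. -/

section Feedback

variable {𝔸 Ω : Type*} [MetricSpace 𝔸] {Q : ControlProblem d p 𝔸} {T : ℝ≥0} {C₀ L : ℝ}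
  {mΩ : MeasurableSpace Ω} {P : Measure Ω} {𝓕 : Filtration ℝ≥0 mΩ} {B : ℝ≥0 → Ω → E p}

/-- Measurable selection of almost optimal feedback for the dynamic programming operator. -/
theorem exists_feedback (hQ : Q.Assumptions T C₀ L) (hC₀ : 0 ≤ C₀) {N i : ℕ} (hi : i ≤ N)
    {W : E d → ℝ} {K : ℝ} (hK : 0 ≤ K) (hW : ∀ x y, |W x - W y| ≤ K * ‖x - y‖) {ε : ℝ}
    (hε : 0 < ε) {η : ℝ} (hη : 0 < η) :
    ∃ (fa : E d → 𝔸) (fe : E d → E d), StronglyMeasurable fa ∧ StronglyMeasurable fe ∧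
      (∀ x, fa x ∈ Q.A) ∧ (∀ x, ‖fe x‖ ≤ ε) ∧
      ∀ x, dpStep Q T N ε i W x - η ≤ oneStep Q T N i W x (fe x) (fa x) := by
  classical
  set K' := K * Real.exp (lipRate p C₀ * timeStep T N)
  have hK' : 0 ≤ K' := by positivity
  have := hQ.nonempty_choice hε
  -- Near-optimal choices are made only at countably many dense points, and each `x` borrows the
  -- choice of a nearby one.
  set y : ℕ → E d := TopologicalSpace.denseSeq (E d)
  have hopt : ∀ j, ∃ q : Choice Q ε,
      dpStep Q T N ε i W (y j) - η / 3 < oneStep Q T N i W (y j) q.2 q.1 := fun j =>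
    exists_lt_of_lt_ciSup (sub_lt_self _ (by positivity))
  choose q hq using hopt
  -- The error `η` splits into three: near-optimality at `y j`, and the Lipschitz errors of `dpStep`
  -- and of `oneStep`. The `+ 1` covers `K' = 0`.
  set r := η / (3 * (K' + 1))
  have hr : 0 < r := by positivity
  have hKr : K' * r ≤ η / 3 := by
    simp only [r]
    rw [mul_div_assoc', div_le_div_iff₀ (by positivity) (by positivity)]
    nlinarith
  have hex : ∀ x, ∃ j, dist x (y j) < r := fun x => by
    obtain ⟨j, hj⟩ := (TopologicalSpace.denseRange_denseSeq (E d)).exists_dist_lt x hr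
    exact ⟨j, hj⟩
  -- Taking the first close enough point makes the index measurable, so no general selection theorem
  -- is needed.
  set J : E d → ℕ := fun x => Nat.find (hex x)
  have hJ : Measurable J :=
    measurable_find hex fun j => measurableSet_lt (by fun_prop) measurable_const
  refine ⟨fun x => (q (J x)).1, fun x => (q (J x)).2,
    (StronglyMeasurable.of_discrete (f := fun j => ((q j).1 : 𝔸))).comp_measurable hJ,
    (StronglyMeasurable.of_discrete (f := fun j => ((q j).2 : E d))).comp_measurable hJ,
    fun x => (q (J x)).1.2, fun x => (q (J x)).norm_le, fun x => ?_⟩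
  have hd : ‖x - y (J x)‖ < r := by
    rw [← dist_eq_norm]
    exact Nat.find_spec (hex x)
  have hKd : K' * ‖x - y (J x)‖ ≤ η / 3 := (by gcongr : _ ≤ K' * r).trans hKr
  have h1 := (abs_le.1 (abs_dpStep_sub_le hQ hC₀ hi hK hW hε x (y (J x)))).2
  have h2 := (abs_le.1 (abs_oneStep_sub_le hQ hC₀ hi hK hW (q (J x)).1.2 (q (J x)).2 x (y (J x)))).1
  have h3 := hq (J x)
  linarith

variable {N n : ℕ} {fa : ℕ → E d → 𝔸} {fe : ℕ → E d → E d} {ε : ℝ}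

theorem stronglyMeasurable_feedbackChain (hQ : Q.Assumptions T C₀ L)
    (hB : IsBrownianMotion B 𝓕 P) (hfa : ∀ i, StronglyMeasurable (fa i))
    (hfe : ∀ i, StronglyMeasurable (fe i)) (hfaA : ∀ i x, fa i x ∈ Q.A) (x : E d) (i : ℕ)
    (hi : i ≤ N) :
    StronglyMeasurable[𝓕 (meshTime T N i)] (feedbackChain Q T N B fa fe n x i) := by
  induction i with
  | zero => exact stronglyMeasurable_const
  | succ i ih =>
    have h := ih (by omega)
    rw [feedbackChain]
    split_ifs
    · exact stronglyMeasurable_eulerStep hQ hB (by omega) h ((hfe i).comp_measurable h.measurable)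
        ((hfa i).comp_measurable h.measurable) fun ω => hfaA _ _
    · exact stronglyMeasurable_const

theorem isStronglyProgressive_feedbackProcess {β : Type*} [MetricSpace β]
    (hQ : Q.Assumptions T C₀ L) (hB : IsBrownianMotion B 𝓕 P) (hT : 0 < T) (hN : 1 ≤ N)
    (hfa : ∀ i, StronglyMeasurable (fa i)) (hfe : ∀ i, StronglyMeasurable (fe i))
    (hfaA : ∀ i x, fa i x ∈ Q.A) (x : E d) {f : ℕ → E d → β}
    (hf : ∀ i, StronglyMeasurable (f i)) :
    IsStronglyProgressive 𝓕 (feedbackProcess Q T N B fa fe n x f) :=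
  isStronglyProgressive_meshIndex hT hN
    (g := fun i ω => f i (feedbackChain Q T N B fa fe n x i ω)) fun i hi =>
    (hf i).comp_measurable
      (stronglyMeasurable_feedbackChain hQ hB hfa hfe hfaA x i hi).measurable

/-- The inequalities of the upper bound are reversed at a loss of `η` in each of the `N - n` steps.
-/
theorem exists_dpValue_sub_le_integral_cost [IsProbabilityMeasure P] (hQ : Q.Assumptions T C₀ L)
    (hC₀ : 0 ≤ C₀) (hB : IsBrownianMotion B 𝓕 P) (hT : 0 < T) (hN : 1 ≤ N) (hε : 0 < ε)
    (hn : n ≤ N) (x : E d) {η : ℝ} (hη : 0 < η) :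
    ∃ α ∈ controls Q.A T N 𝓕, ∃ e ∈ perturbations d ε T N 𝓕,
      dpValue Q T N ε (N - n) x - (N - n : ℕ) * η
        ≤ ∫ ω, Q.ψ (perturbedEuler Q T N B α e n x N ω) ∂P := by
  have hK : 0 ≤ L * lipConst p T C₀ := mul_nonneg hQ.L_nonneg (lipConst_nonneg p T C₀)
  have hsel : ∀ i, ∃ (fa : E d → 𝔸) (fe : E d → E d), StronglyMeasurable fa ∧
      StronglyMeasurable fe ∧ (∀ x, fa x ∈ Q.A) ∧ (∀ x, ‖fe x‖ ≤ ε) ∧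
      -- The minimum lets feedback be chosen for every natural `i`; only indices below `N` matter,
      -- where it is `i`.
      ∀ x, dpStep Q T N ε (min i N) (dpValue Q T N ε (N - (i + 1))) x - η
        ≤ oneStep Q T N (min i N) (dpValue Q T N ε (N - (i + 1))) x (fe x) (fa x) := fun i =>
    exists_feedback hQ hC₀ (min_le_right _ _) hK
      (fun x y => abs_dpValue_sub_le hQ hC₀ hN hε (Nat.sub_le _ _) x y) hε hη
  choose fa fe hfa hfe hfaA hfeε hopt using hsel
  have hα : feedbackProcess Q T N B fa fe n x fa ∈ controls Q.A T N 𝓕 :=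
    ⟨isStronglyProgressive_feedbackProcess hQ hB hT hN hfa hfe hfaA x hfa, fun _ _ => hfaA _ _,
      isPiecewiseConstant_feedbackProcess hT hN x fa⟩
  have he : feedbackProcess Q T N B fa fe n x fe ∈ perturbations d ε T N 𝓕 :=
    ⟨isStronglyProgressive_feedbackProcess hQ hB hT hN hfa hfe hfaA x hfe, fun _ _ => hfeε _ _,
      isPiecewiseConstant_feedbackProcess hT hN x fe⟩
  refine ⟨_, hα, _, he, ?_⟩
  have hspec := fun i (hi : i ≤ N) => perturbedEuler_spec (n := n) hQ hC₀ hB hα he x i hi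
  simp only [perturbedEuler_feedbackProcess hT hN x N le_rfl]
  have key : ∀ k, n + k ≤ N →
      ∫ ω, dpValue Q T N ε k (feedbackChain Q T N B fa fe n x (N - k) ω) ∂P - k * η
        ≤ ∫ ω, Q.ψ (feedbackChain Q T N B fa fe n x N ω) ∂P := by
    intro k
    induction k with
    | zero => simp [dpValue]
    | succ k ih =>
      intro hk
      refine le_trans ?_ (ih (by omega))
      have hi : N - (k + 1) ≤ N := Nat.sub_le _ _
      obtain ⟨h1, h2⟩ := hspec _ hi
      rw [perturbedEuler_feedbackProcess hT hN x _ hi] at h1 h2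
      have hLip := fun x y : E d => abs_dpValue_sub_le hQ hC₀ hN hε (show k ≤ N by omega) x y
      have hLip' := fun x y : E d => abs_dpValue_sub_le hQ hC₀ hN hε (show k + 1 ≤ N by omega) x y
      have hstep := feedbackChain_succ (Q := Q) (T := T) (N := N) (B := B) (fa := fa) (fe := fe) x
        (show n ≤ N - (k + 1) by omega)
      rw [show N - (k + 1) + 1 = N - k by omega] at hstep
      obtain ⟨hint, heq⟩ := integral_comp_eulerStep hQ hC₀ hB hi h1
        ((hfe (N - (k + 1))).comp_measurable h1.measurable)
        ((hfa (N - (k + 1))).comp_measurable h1.measurable) (fun ω => hfaA _ _)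
        (fun ω => hfeε _ _) h2 hLip
      have hmono := integral_mono
        ((integrable_comp_of_abs_sub_le hLip' h2).sub (integrable_const η)) hint fun ω => by
          have := hopt (N - (k + 1)) (feedbackChain Q T N B fa fe n x (N - (k + 1)) ω)
          rw [min_eq_left hi, show N - (N - (k + 1) + 1) = k by omega] at this
          exact this
      rw [hstep]
      simp only [Pi.sub_apply] at hmono
      rw [integral_sub (integrable_comp_of_abs_sub_le hLip' h2) (integrable_const η)] at hmono
      simp only [Function.comp_def] at heq hmono
      rw [heq]
      simp only [integral_const, probReal_univ, one_smul] at hmono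
      push_cast
      linarith
  have hfin := key (N - n) (by omega)
  have h0 : feedbackChain Q T N B fa fe n x (N - (N - n)) = fun _ => x := by
    rw [← perturbedEuler_feedbackProcess hT hN x _ (by omega),
      perturbedEuler_of_le x (by omega)]
  simpa [h0] using hfin

theorem const_mem_controls {a : 𝔸} (ha : a ∈ Q.A) :
    (fun _ _ => a : ℝ≥0 → Ω → 𝔸) ∈ controls Q.A T N 𝓕 :=
  ⟨isStronglyProgressive_const 𝓕 a, fun _ _ => ha, fun _ _ _ _ _ => rfl⟩

theorem const_mem_perturbations {e : E d} (he : ‖e‖ ≤ ε) :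
    (fun _ _ => e : ℝ≥0 → Ω → E d) ∈ perturbations d ε T N 𝓕 :=
  ⟨isStronglyProgressive_const 𝓕 e, fun _ _ => he, fun _ _ _ _ _ => rfl⟩

theorem bddAbove_integral_cost [IsProbabilityMeasure P] (hQ : Q.Assumptions T C₀ L)
    (hC₀ : 0 ≤ C₀) (hB : IsBrownianMotion B 𝓕 P) (hε : 0 < ε) (hn : n ≤ N) (x : E d) :
    BddAbove (range fun q : controls Q.A T N 𝓕 × perturbations d ε T N 𝓕 =>
      ∫ ω, Q.ψ (perturbedEuler Q T N B q.1 q.2 n x N ω) ∂P) := by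
  refine ⟨dpValue Q T N ε (N - n) x, ?_⟩
  rintro _ ⟨q, rfl⟩
  exact integral_cost_le_dpValue hQ hC₀ hB hε hn q.1.2 q.2.2 x

/-- Dynamic programming: the perturbed value function is given by backward recursion. -/
theorem perturbedValue_eq_dpValue [IsProbabilityMeasure P] (hQ : Q.Assumptions T C₀ L)
    (hC₀ : 0 ≤ C₀) (hB : IsBrownianMotion B 𝓕 P) (hT : 0 < T) (hN : 1 ≤ N) (hε : 0 < ε)
    (hn : n ≤ N) (x : E d) :
    perturbedValue Q T N 𝓕 P B ε n x = dpValue Q T N ε (N - n) x := by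
  obtain ⟨a, ha⟩ := hQ.nonempty
  have : Nonempty (controls Q.A T N 𝓕 × perturbations d ε T N 𝓕) :=
    ⟨⟨_, const_mem_controls ha⟩, ⟨_, const_mem_perturbations (e := 0) (by simpa using hε.le)⟩⟩
  refine le_antisymm
    (ciSup_le fun q => integral_cost_le_dpValue hQ hC₀ hB hε hn q.1.2 q.2.2 x) ?_
  refine le_of_forall_pos_le_add fun ρ hρ => ?_
  -- The allowed error `ρ` is shared among the steps; the `+ 1` covers `n = N`.
  have hpos : (0 : ℝ) < (N - n : ℕ) + 1 := by positivity
  obtain ⟨α, hα, e, he, h⟩ :=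
    exists_dpValue_sub_le_integral_cost hQ hC₀ hB hT hN hε hn x (div_pos hρ hpos)
  have h1 : ∫ ω, Q.ψ (perturbedEuler Q T N B α e n x N ω) ∂P
      ≤ perturbedValue Q T N 𝓕 P B ε n x :=
    le_ciSup (bddAbove_integral_cost hQ hC₀ hB hε hn x)
      ((⟨α, hα⟩, ⟨e, he⟩) : controls Q.A T N 𝓕 × perturbations d ε T N 𝓕)
  have h2 : ((N - n : ℕ) : ℝ) * (ρ / ((N - n : ℕ) + 1)) ≤ ρ := by
    rw [mul_div_assoc', div_le_iff₀ hpos]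
    nlinarith
  linarith

end Feedback

/-! ### Derivatives of convolutions. -/

section Convolution

open scoped Convolution

theorem fderiv_convolution_lsmul {F : Type*} [NormedAddCommGroup F] [NormedSpace ℝ F]
    [CompleteSpace F] {f : E d → ℝ} (hf : LocallyIntegrable f) {g : E d → F}
    (hgc : HasCompactSupport g) (hg : ContDiff ℝ (⊤ : ℕ∞) g) :
    fderiv ℝ (f ⋆[ContinuousLinearMap.lsmul ℝ ℝ] g)
      = f ⋆[ContinuousLinearMap.lsmul ℝ ℝ] fderiv ℝ g := by
  funext x
  rw [(hgc.hasFDerivAt_convolution_right (ContinuousLinearMap.lsmul ℝ ℝ) hf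
    (hg.of_le (by exact_mod_cast le_top)) x).fderiv]
  rfl

/-- Each derivative falls on `g`, whose values then move to a space of linear maps; hence the
induction with `F` arbitrary. -/
theorem norm_iteratedFDeriv_convolution_le {F : Type} [NormedAddCommGroup F] [NormedSpace ℝ F]
    [CompleteSpace F] {f : E d → ℝ} (hf : LocallyIntegrable f) {g : E d → F}
    (hgc : HasCompactSupport g) (hg : ContDiff ℝ (⊤ : ℕ∞) g) (k : ℕ) (x : E d) :
    ‖iteratedFDeriv ℝ k (f ⋆[ContinuousLinearMap.lsmul ℝ ℝ] g) x‖
      ≤ ∫ t, |f t| * ‖iteratedFDeriv ℝ k g (x - t)‖ := by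
  induction k generalizing F with
  | zero =>
    simp only [norm_iteratedFDeriv_zero]
    refine (norm_integral_le_integral_norm _).trans_eq ?_
    simp [norm_smul]
  | succ k ih =>
    rw [← norm_iteratedFDeriv_fderiv, fderiv_convolution_lsmul hf hgc hg]
    refine (ih (hgc.fderiv (𝕜 := ℝ)) (hg.fderiv_right (by exact_mod_cast le_top))).trans_eq ?_
    simp only [norm_iteratedFDeriv_fderiv]

end Convolution

/-! ### Scaling of the mollifier. -/

section ScaledMollifier

variable {δ : E d → ℝ} {ε : ℝ}

theorem IsMollifier.contDiff_scaled (hδ : IsMollifier δ) (ε : ℝ) :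
    ContDiff ℝ (⊤ : ℕ∞) (scaledMollifier δ ε) :=
  contDiff_const.mul (hδ.smooth.comp (contDiff_const_smul _))

theorem IsMollifier.continuous_scaled (hδ : IsMollifier δ) (ε : ℝ) :
    Continuous (scaledMollifier δ ε) :=
  (hδ.contDiff_scaled ε).continuous

theorem IsMollifier.scaled_nonneg (hδ : IsMollifier δ) (hε : 0 < ε) (x : E d) :
    0 ≤ scaledMollifier δ ε x :=
  mul_nonneg (by positivity) (hδ.nonneg _)

theorem IsMollifier.scaled_eq_zero (hδ : IsMollifier δ) (hε : 0 < ε) {x : E d} (hx : ε < ‖x‖) :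
    scaledMollifier δ ε x = 0 := by
  have h : δ (ε⁻¹ • x) = 0 := by
    by_contra h
    have := hδ.support_subset h
    rw [mem_closedBall_zero_iff, norm_smul, norm_inv, Real.norm_of_nonneg hε.le,
      inv_mul_le_iff₀ hε, mul_one] at this
    exact absurd this hx.not_ge
  rw [scaledMollifier, h, mul_zero]

theorem IsMollifier.hasCompactSupport_scaled (hδ : IsMollifier δ) (hε : 0 < ε) :
    HasCompactSupport (scaledMollifier δ ε) :=
  HasCompactSupport.intro (isCompact_closedBall 0 ε) fun x hx =>
    hδ.scaled_eq_zero hε (by simpa using hx)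

theorem IsMollifier.integrable_scaled (hδ : IsMollifier δ) (hε : 0 < ε) :
    Integrable (scaledMollifier δ ε) :=
  (hδ.continuous_scaled ε).integrable_of_hasCompactSupport (hδ.hasCompactSupport_scaled hε)

theorem integral_comp_inv_smul_euclidean (hε : 0 < ε) (f : E d → ℝ) :
    ∫ x, f (ε⁻¹ • x) = ε ^ d * ∫ x, f x := by
  rw [Measure.integral_comp_inv_smul, finrank_euclideanSpace_fin, abs_of_pos (by positivity),
    smul_eq_mul]

theorem IsMollifier.integral_scaled (hδ : IsMollifier δ) (hε : 0 < ε) :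
    ∫ x, scaledMollifier δ ε x = 1 := by
  simp only [scaledMollifier]
  rw [integral_const_mul, integral_comp_inv_smul_euclidean hε, hδ.integral_eq_one]
  field_simp

theorem IsMollifier.norm_iteratedFDeriv_scaled (hδ : IsMollifier δ) (hε : 0 < ε) (k : ℕ) (x : E d) :
    ‖iteratedFDeriv ℝ k (scaledMollifier δ ε) x‖
      = (ε ^ d)⁻¹ * (ε⁻¹ ^ k * ‖iteratedFDeriv ℝ k δ (ε⁻¹ • x)‖) := by
  have hs : ContDiff ℝ k δ := hδ.smooth.of_le (by exact_mod_cast le_top)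
  have e : scaledMollifier δ ε = (ε ^ d)⁻¹ • fun x => δ (ε⁻¹ • x) := rfl
  have hs' : ContDiff ℝ k fun x => δ (ε⁻¹ • x) := hs.comp (contDiff_const_smul _)
  rw [e, iteratedFDeriv_const_smul_apply hs'.contDiffAt,
    iteratedFDeriv_comp_const_smul _ hs, norm_smul, norm_smul,
    Real.norm_of_nonneg (by positivity), Real.norm_of_nonneg (by positivity)]

/-- The first absolute moment of the `k`-th derivative of the mollifier. -/
def derivMoment (δ : E d → ℝ) (k : ℕ) : ℝ := ∫ v, ‖v‖ * ‖iteratedFDeriv ℝ k δ v‖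

theorem derivMoment_nonneg (δ : E d → ℝ) (k : ℕ) : 0 ≤ derivMoment δ k :=
  integral_nonneg fun _ => by positivity

/-- Under `u = ε v` the volume factor cancels `ε ^ (-d)`, the `k` derivatives give `ε ^ (-k)` and
the weight `‖u‖` returns one `ε`. -/
theorem IsMollifier.integral_norm_mul_iteratedFDeriv_scaled (hδ : IsMollifier δ) (hε : 0 < ε)
    (k : ℕ) :
    ∫ u, ‖u‖ * ‖iteratedFDeriv ℝ k (scaledMollifier δ ε) u‖
      = derivMoment δ k * ε ^ (1 - (k : ℤ)) := by
  have h1 : ∀ u : E d, ‖u‖ * ‖iteratedFDeriv ℝ k (scaledMollifier δ ε) u‖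
      = (ε ^ d)⁻¹ * ε⁻¹ ^ k * ε * (‖ε⁻¹ • u‖ * ‖iteratedFDeriv ℝ k δ (ε⁻¹ • u)‖) := fun u => by
    rw [hδ.norm_iteratedFDeriv_scaled hε, norm_smul, norm_inv, Real.norm_of_nonneg hε.le]
    field_simp
  simp_rw [h1]
  rw [integral_const_mul,
    integral_comp_inv_smul_euclidean hε fun v => ‖v‖ * ‖iteratedFDeriv ℝ k δ v‖,
    derivMoment, zpow_sub₀ hε.ne', zpow_one, zpow_natCast, inv_pow]
  field_simp

theorem IsMollifier.integrable_norm_mul_iteratedFDeriv_scaled (hδ : IsMollifier δ) (hε : 0 < ε)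
    (k : ℕ) : Integrable fun u => ‖u‖ * ‖iteratedFDeriv ℝ k (scaledMollifier δ ε) u‖ := by
  have hc : Continuous (iteratedFDeriv ℝ k (scaledMollifier δ ε)) :=
    (hδ.contDiff_scaled ε).continuous_iteratedFDeriv (by exact_mod_cast le_top)
  exact (continuous_norm.mul hc.norm).integrable_of_hasCompactSupport
    (((hδ.hasCompactSupport_scaled hε).iteratedFDeriv k).norm.mul_left)

end ScaledMollifier

/-! ### Mollification of Lipschitz functions. -/

section Mollify

/-- The mollification of `W` at scale `ε`. -/
def mollify (δ : E d → ℝ) (ε : ℝ) (W : E d → ℝ) (x : E d) : ℝ :=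
  ∫ ξ, W (x - ξ) * scaledMollifier δ ε ξ

variable {δ : E d → ℝ} {ε K : ℝ} {W : E d → ℝ}

theorem integrable_mul_scaledMollifier (hδ : IsMollifier δ) (hε : 0 < ε) (hW : Continuous W) :
    Integrable fun ξ => W ξ * scaledMollifier δ ε ξ :=
  (hW.mul (hδ.continuous_scaled ε)).integrable_of_hasCompactSupport
    ((hδ.hasCompactSupport_scaled hε).mul_left)

theorem integrable_mollify (hδ : IsMollifier δ) (hε : 0 < ε) (hW : Continuous W) (x : E d) :
    Integrable fun ξ => W (x - ξ) * scaledMollifier δ ε ξ :=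
  integrable_mul_scaledMollifier hδ hε (W := fun ξ => W (x - ξ)) (by fun_prop)

/-- The rescaled mollifier is a probability density carried by the ball of radius `ε`, so only
values on that ball count. -/
theorem abs_integral_mul_scaledMollifier_le (hδ : IsMollifier δ) (hε : 0 < ε) {f : E d → ℝ} {M : ℝ}
    (hf : ∀ ξ, ‖ξ‖ ≤ ε → |f ξ| ≤ M) : |∫ ξ, f ξ * scaledMollifier δ ε ξ| ≤ M := by
  have h := norm_integral_le_of_norm_le ((hδ.integrable_scaled hε).const_mul M)
    (f := fun ξ => f ξ * scaledMollifier δ ε ξ) (ae_of_all _ fun ξ => ?_)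
  · rwa [integral_const_mul, hδ.integral_scaled hε, mul_one] at h
  · rw [norm_mul, Real.norm_of_nonneg (hδ.scaled_nonneg hε ξ)]
    rcases le_or_gt ‖ξ‖ ε with h | h
    · exact mul_le_mul_of_nonneg_right (hf ξ h) (hδ.scaled_nonneg hε ξ)
    · simp [hδ.scaled_eq_zero hε h]

theorem abs_mollify_sub_self_le (hδ : IsMollifier δ) (hε : 0 < ε) (hK : 0 ≤ K)
    (hW : ∀ x y, |W x - W y| ≤ K * ‖x - y‖) (x : E d) :
    |mollify δ ε W x - W x| ≤ K * ε := by
  have h1 : mollify δ ε W x - W x = ∫ ξ, (W (x - ξ) - W x) * scaledMollifier δ ε ξ := by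
    simp_rw [sub_mul]
    rw [integral_sub (integrable_mollify hδ hε (continuous_of_abs_sub_le hW) x)
      ((hδ.integrable_scaled hε).const_mul _), integral_const_mul, hδ.integral_scaled hε, mul_one,
      mollify]
  rw [h1]
  refine abs_integral_mul_scaledMollifier_le hδ hε fun ξ hξ => (hW _ _).trans ?_
  simp only [sub_sub_cancel_left, norm_neg]
  gcongr

theorem abs_mollify_sub_le (hδ : IsMollifier δ) (hε : 0 < ε)
    (hW : ∀ x y, |W x - W y| ≤ K * ‖x - y‖) (x y : E d) :
    |mollify δ ε W x - mollify δ ε W y| ≤ K * ‖x - y‖ := by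
  have hc := continuous_of_abs_sub_le hW
  rw [mollify, mollify, ← integral_sub (integrable_mollify hδ hε hc x)
    (integrable_mollify hδ hε hc y)]
  simp_rw [← sub_mul]
  refine abs_integral_mul_scaledMollifier_le hδ hε fun ξ _ => (hW _ _).trans_eq ?_
  simp

open scoped Convolution in
theorem mollify_eq_convolution :
    mollify δ ε W = W ⋆[ContinuousLinearMap.lsmul ℝ ℝ] scaledMollifier δ ε := by
  funext x
  rw [mollify, convolution, ← integral_sub_left_eq_self _ _ x]
  simp

theorem contDiff_mollify (hδ : IsMollifier δ) (hε : 0 < ε) (hW : Continuous W) :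
    ContDiff ℝ (⊤ : ℕ∞) (mollify δ ε W) := by
  rw [mollify_eq_convolution]
  exact (hδ.hasCompactSupport_scaled hε).contDiff_convolution_right _ hW.locallyIntegrable
    (hδ.contDiff_scaled ε)

theorem mollify_sub_const (hδ : IsMollifier δ) (hε : 0 < ε) (hW : Continuous W) (c : ℝ) :
    mollify δ ε (fun x => W x - c) = fun x => mollify δ ε W x - c := by
  funext x
  simp only [mollify, sub_mul]
  rw [integral_sub (integrable_mollify hδ hε hW x) ((hδ.integrable_scaled hε).const_mul _),
    integral_const_mul, hδ.integral_scaled hε, mul_one]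

theorem norm_iteratedFDeriv_mollify_le (hδ : IsMollifier δ) (hε : 0 < ε)
    (hW : ∀ x y, |W x - W y| ≤ K * ‖x - y‖) {k : ℕ} (hk : 1 ≤ k) (x : E d) :
    ‖iteratedFDeriv ℝ k (mollify δ ε W) x‖ ≤ K * derivMoment δ k * ε ^ (1 - (k : ℤ)) := by
  have hc := continuous_of_abs_sub_le hW
  have hc' : Continuous fun y => W y - W x := by fun_prop
  obtain ⟨j, rfl⟩ : ∃ j, k = j + 1 := ⟨k - 1, by omega⟩
  -- Subtracting the constant `W x` changes no derivative of order at least one, and lets `|W t - W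
  -- x| ≤ K ‖x - t‖` supply the weight in `derivMoment`.
  have h1 : ‖iteratedFDeriv ℝ (j + 1) (mollify δ ε W) x‖
      = ‖iteratedFDeriv ℝ (j + 1) (mollify δ ε fun y => W y - W x) x‖ := by
    rw [mollify_sub_const hδ hε hc, ← norm_iteratedFDeriv_fderiv, ← norm_iteratedFDeriv_fderiv]
    congr 2
    funext y
    rw [fderiv_sub_const]
  rw [h1, mollify_eq_convolution, mul_assoc, ← hδ.integral_norm_mul_iteratedFDeriv_scaled hε,
    ← integral_const_mul]
  refine (norm_iteratedFDeriv_convolution_le hc'.locallyIntegrable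
    (hδ.hasCompactSupport_scaled hε) (hδ.contDiff_scaled ε) (j + 1) x).trans ?_
  rw [← integral_sub_left_eq_self (fun u => K * (‖u‖ *
    ‖iteratedFDeriv ℝ (j + 1) (scaledMollifier δ ε) u‖)) _ x]
  have hint := ((hδ.integrable_norm_mul_iteratedFDeriv_scaled hε (j + 1)).const_mul K).comp_sub_left x
  refine integral_mono_of_nonneg (ae_of_all _ fun t => by positivity) hint (ae_of_all _ fun t => ?_)
  simp only
  rw [← mul_assoc]
  refine mul_le_mul_of_nonneg_right ((hW t x).trans_eq ?_) (norm_nonneg _)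
  rw [norm_sub_rev]

/-- Fubini, together with the fact that translating the argument of `W` by `-ξ` is the same as
translating the mean `m`. -/
theorem stepMean_mollify (hδ : IsMollifier δ) (hε : 0 < ε)
    (hW : ∀ x y, |W x - W y| ≤ K * ‖x - y‖) (r : ℝ) (m : E d) (s : E p →L[ℝ] E d) :
    stepMean r (mollify δ ε W) m s
      = ∫ ξ, stepMean r W (m - ξ) s * scaledMollifier δ ε ξ := by
  have hc := continuous_of_abs_sub_le hW
  have hφ := hδ.continuous_scaled ε
  simp only [stepMean, mollify]
  have hint : Integrable (Function.uncurry fun (z : E p) (ξ : E d) =>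
      W (m + s z - ξ) * scaledMollifier δ ε ξ) ((noiseLaw p r).prod volume) := by
    -- Linear growth of `W` and `‖ξ‖ ≤ ε` on the support give a dominating function that is a
    -- product in `z` and `ξ`.
    have hb : Integrable (fun q : E p × E d =>
        (|W 0| + |K| * (‖m + s q.1‖ + ε)) * scaledMollifier δ ε q.2)
        ((noiseLaw p r).prod volume) :=
      Integrable.mul_prod (f := fun z => |W 0| + |K| * (‖m + s z‖ + ε))
        ((integrable_const _).add
          (((integrable_affine_noiseLaw r m s).norm.add (integrable_const ε)).const_mul _))
        (hδ.integrable_scaled hε)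
    refine hb.mono' (Continuous.aestronglyMeasurable (by fun_prop)) (ae_of_all _ fun q => ?_)
    obtain ⟨z, ξ⟩ := q
    simp only [Function.uncurry_apply_pair]
    rw [norm_mul, Real.norm_of_nonneg (hδ.scaled_nonneg hε ξ)]
    rcases le_or_gt ‖ξ‖ ε with h | h
    · refine mul_le_mul_of_nonneg_right ?_ (hδ.scaled_nonneg hε ξ)
      have h1 := (hW (m + s z - ξ) 0).trans
        (mul_le_mul_of_nonneg_right (le_abs_self K) (norm_nonneg _))
      rw [sub_zero] at h1
      have h2 := abs_sub_abs_le_abs_sub (W (m + s z - ξ)) (W 0)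
      have h3 : |K| * ‖m + s z - ξ‖ ≤ |K| * (‖m + s z‖ + ε) := by
        have := norm_sub_le (m + s z) ξ
        gcongr
        linarith
      rw [Real.norm_eq_abs]
      linarith
    · simp [hδ.scaled_eq_zero hε h]
  rw [integral_integral_swap hint]
  refine integral_congr_ae (ae_of_all _ fun ξ => ?_)
  simp only
  rw [← integral_mul_const]
  refine integral_congr_ae (ae_of_all _ fun z => ?_)
  simp only
  congr 2
  abel

end Mollify

/-! ### Shaking the coefficients: the one-step inequality. -/

section Supersolution

variable {𝔸 : Type*} [MetricSpace 𝔸] {Q : ControlProblem d p 𝔸} {T : ℝ≥0} {C₀ L : ℝ}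
  {δ : E d → ℝ} {ε K : ℝ} {W : E d → ℝ}

/-- For each `ξ` in the support of the mollifier, the step from `x - ξ` with perturbation `ξ` uses
the coefficients at `x`. Its mean, which is at most `dpStep` at `x - ξ`, is the integrand on the
left. -/
theorem oneStep_mollify_le (hQ : Q.Assumptions T C₀ L) (hC₀ : 0 ≤ C₀) {N i : ℕ} (hi : i ≤ N)
    (hK : 0 ≤ K) (hW : ∀ x y, |W x - W y| ≤ K * ‖x - y‖) (hδ : IsMollifier δ) (hε : 0 < ε) {a : 𝔸}
    (ha : a ∈ Q.A) (x : E d) :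
    oneStep Q T N i (mollify δ ε W) x 0 a ≤ mollify δ ε (dpStep Q T N ε i W) x := by
  rw [oneStep, stepMean_mollify hδ hε hW, mollify]
  have hs : Continuous fun ξ : E d => stepMean (timeStep T N : ℝ) W
      (x + (timeStep T N : ℝ) • Q.μ (meshTime T N i) (x + 0) a - ξ)
      (Q.σ (meshTime T N i) (x + 0) a) :=
    (continuous_stepMean (p := p) (coe_timeStep_nonneg T N) hK hW).comp
      (f := fun ξ : E d => (x + (timeStep T N : ℝ) • Q.μ (meshTime T N i) (x + 0) a - ξ,
        Q.σ (meshTime T N i) (x + 0) a)) (by fun_prop)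
  refine integral_mono (integrable_mul_scaledMollifier hδ hε hs) (integrable_mollify hδ hε
    (continuous_of_abs_sub_le (abs_dpStep_sub_le hQ hC₀ hi hK hW hε)) x) fun ξ => ?_
  rcases le_or_gt ‖ξ‖ ε with h | h
  · refine mul_le_mul_of_nonneg_right ?_ (hδ.scaled_nonneg hε ξ)
    refine le_trans (le_of_eq ?_) (oneStep_le_dpStep hQ hC₀ hi hK hW ha h (x - ξ))
    -- The perturbation undoes the shift, `(x - ξ) + ξ = x`, inside both coefficients.
    rw [oneStep, sub_add_cancel, add_zero, add_sub_right_comm]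
  · simp [hδ.scaled_eq_zero hε h]

variable {Ω : Type*} {mΩ : MeasurableSpace Ω} {P : Measure Ω} {𝓕 : Filtration ℝ≥0 mΩ}
  {B : ℝ≥0 → Ω → E p} {N n : ℕ}

theorem mollifiedValue_eq [IsProbabilityMeasure P] (hQ : Q.Assumptions T C₀ L)
    (hC₀ : 0 ≤ C₀) (hB : IsBrownianMotion B 𝓕 P) (hT : 0 < T) (hN : 1 ≤ N) (hε : 0 < ε)
    (hn : n ≤ N) :
    mollifiedValue Q T N 𝓕 P B δ ε n = mollify δ ε (dpValue Q T N ε (N - n)) := by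
  funext x
  simp only [mollifiedValue, mollify, perturbedValue_eq_dpValue hQ hC₀ hB hT hN hε hn]

theorem valuesWellDefined [IsProbabilityMeasure P] (hQ : Q.Assumptions T C₀ L)
    (hC₀ : 0 ≤ C₀) (hB : IsBrownianMotion B 𝓕 P) (hT : 0 < T) (hN : 1 ≤ N) (hδ : IsMollifier δ)
    (hε : 0 < ε) : ValuesWellDefined Q T N 𝓕 P B δ ε := by
  refine fun n hn x => ⟨fun α hα e he => integrable_cost hQ hC₀ hB hα he x,
    bddAbove_integral_cost hQ hC₀ hB hε hn x, ?_⟩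
  simp only [perturbedValue_eq_dpValue hQ hC₀ hB hT hN hε hn]
  exact integrable_mollify hδ hε
    (continuous_of_abs_sub_le (abs_dpValue_sub_le hQ hC₀ hN hε (Nat.sub_le N n))) x

theorem integral_mollifiedValue_euler [IsProbabilityMeasure P] (hQ : Q.Assumptions T C₀ L)
    (hC₀ : 0 ≤ C₀) (hB : IsBrownianMotion B 𝓕 P) (hT : 0 < T) (hN : 1 ≤ N) (hδ : IsMollifier δ)
    (hε : 0 < ε) (hn : n < N) (x : E d) {a : 𝔸} (ha : a ∈ Q.A) :
    Integrable (fun ω => mollifiedValue Q T N 𝓕 P B δ ε (n + 1)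
        (euler Q T N B (fun _ _ => a) n x (n + 1) ω)) P ∧
      ∫ ω, mollifiedValue Q T N 𝓕 P B δ ε (n + 1)
        (euler Q T N B (fun _ _ => a) n x (n + 1) ω) ∂P
        ≤ mollifiedValue Q T N 𝓕 P B δ ε n x := by
  have hK : 0 ≤ L * lipConst p T C₀ := mul_nonneg hQ.L_nonneg (lipConst_nonneg p T C₀)
  have hLip := abs_dpValue_sub_le hQ hC₀ hN hε (Nat.sub_le N (n + 1))
  have hLipM := abs_mollify_sub_le hδ hε hLip
  have hstep : euler Q T N B (fun _ _ => a) n x (n + 1)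
      = eulerStep Q T N B n (fun _ => x) (fun _ => 0) (fun _ => a) := by
    rw [euler, perturbedEuler_succ x le_rfl, perturbedEuler_of_le x le_rfl]
  have h0 : ∀ ω : Ω, ‖(fun _ => 0 : Ω → E d) ω‖ ≤ ε := fun _ => by simpa using hε.le
  rw [mollifiedValue_eq hQ hC₀ hB hT hN hε hn, mollifiedValue_eq hQ hC₀ hB hT hN hε hn.le, hstep]
  refine ⟨integrable_comp_of_abs_sub_le hLipM (integrable_eulerStep hQ hC₀ hB hn.le
    stronglyMeasurable_const stronglyMeasurable_const stronglyMeasurable_const (fun _ => ha) h0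
    (integrable_const x)), ?_⟩
  rw [(integral_comp_eulerStep hQ hC₀ hB hn.le stronglyMeasurable_const stronglyMeasurable_const
    stronglyMeasurable_const (fun _ => ha) h0 (integrable_const x) hLipM).2]
  -- Since `n < N`, at least one step remains and the recursion unfolds once, at mesh index `n`.
  have hdp : dpValue Q T N ε (N - n) = dpStep Q T N ε n (dpValue Q T N ε (N - (n + 1))) := by
    rw [show N - n = N - (n + 1) + 1 by omega, dpValue, show N - (N - (n + 1) + 1) = n by omega]
  rw [hdp]
  simpa using oneStep_mollify_le hQ hC₀ hn.le hK hLip hδ hε ha x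

end Supersolution

end ShakenControl

end

/-! ### The proposition. -/

theorem mainTheorem4 (d p : ℕ) (T : ℝ≥0) (hT : 0 < T) (C₀ : ℝ) (hC₀ : 0 ≤ C₀) :
    ∃ C₁ : ℝ, 0 ≤ C₁ ∧
    ∀ δ : ShakenControl.E d → ℝ, ShakenControl.IsMollifier δ →
    ∃ C₂ : ℕ → ℝ, (∀ k, 0 ≤ C₂ k) ∧
    ∀ (𝔸 : Type*) [MetricSpace 𝔸] [TopologicalSpace.SeparableSpace 𝔸]
      (Q : ShakenControl.ControlProblem d p 𝔸) (L : ℝ) (_ : Q.Assumptions T C₀ L)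
      (Ω : Type*) (mΩ : MeasurableSpace Ω) (P : Measure Ω) (_ : IsProbabilityMeasure P)
      (𝓕 : Filtration ℝ≥0 mΩ) (B : ℝ≥0 → Ω → ShakenControl.E p)
      (_ : ShakenControl.IsBrownianMotion B 𝓕 P)
      (N : ℕ) (_ : 1 ≤ N) (ε : ℝ) (_ : 0 < ε),
    ShakenControl.ValuesWellDefined Q T N 𝓕 P B δ ε ∧
    -- (i)
    (∀ n ≤ N, ∀ x : ShakenControl.E d,
      |ShakenControl.mollifiedValue Q T N 𝓕 P B δ ε n x
        - ShakenControl.perturbedValue Q T N 𝓕 P B ε n x| ≤ L * C₁ * ε) ∧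
    -- (ii)
    (∀ n ≤ N, ContDiff ℝ (⊤ : ℕ∞) (ShakenControl.mollifiedValue Q T N 𝓕 P B δ ε n) ∧
      ∀ k : ℕ, 1 ≤ k → ∀ x : ShakenControl.E d,
        ‖iteratedFDeriv ℝ k (ShakenControl.mollifiedValue Q T N 𝓕 P B δ ε n) x‖
          ≤ L * C₂ k * ε ^ (1 - (k : ℤ))) ∧
    -- (iii)
    (∀ n < N, ∀ x : ShakenControl.E d,
      (∀ a ∈ Q.A, Integrable (fun ω => ShakenControl.mollifiedValue Q T N 𝓕 P B δ ε (n + 1)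
        (ShakenControl.euler Q T N B (fun _ _ => a) n x (n + 1) ω)) P) ∧
      BddAbove (range fun a : Q.A => ∫ ω, ShakenControl.mollifiedValue Q T N 𝓕 P B δ ε (n + 1)
        (ShakenControl.euler Q T N B (fun _ _ => a) n x (n + 1) ω) ∂P) ∧
      ⨆ a : Q.A, ∫ ω, ShakenControl.mollifiedValue Q T N 𝓕 P B δ ε (n + 1)
        (ShakenControl.euler Q T N B (fun _ _ => a) n x (n + 1) ω) ∂P
        ≤ ShakenControl.mollifiedValue Q T N 𝓕 P B δ ε n x) := by
  -- Both constants are fixed before the control problem, the probability space, `N` and `ε`; only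
  -- the second involves `δ`, through `derivMoment`.
  refine ⟨ShakenControl.lipConst p T C₀, ShakenControl.lipConst_nonneg p T C₀, fun δ hδ =>
    ⟨fun k => ShakenControl.lipConst p T C₀ * ShakenControl.derivMoment δ k, fun k =>
      mul_nonneg (ShakenControl.lipConst_nonneg p T C₀) (ShakenControl.derivMoment_nonneg δ k), ?_⟩⟩
  intro 𝔸 _ _ Q L hQ Ω mΩ P _ 𝓕 B hB N hN ε hε
  have hK : 0 ≤ L * ShakenControl.lipConst p T C₀ :=
    mul_nonneg hQ.L_nonneg (ShakenControl.lipConst_nonneg p T C₀)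
  have hLip := fun n => ShakenControl.abs_dpValue_sub_le hQ hC₀ hN hε (Nat.sub_le N n)
  refine ⟨ShakenControl.valuesWellDefined hQ hC₀ hB hT hN hδ hε, fun n hn x => ?_,
    fun n hn => ?_, fun n hn x => ?_⟩
  · rw [ShakenControl.mollifiedValue_eq hQ hC₀ hB hT hN hε hn,
      ShakenControl.perturbedValue_eq_dpValue hQ hC₀ hB hT hN hε hn]
    exact ShakenControl.abs_mollify_sub_self_le hδ hε hK (hLip n) x
  · rw [ShakenControl.mollifiedValue_eq hQ hC₀ hB hT hN hε hn]
    refine ⟨ShakenControl.contDiff_mollify hδ hε (ShakenControl.continuous_of_abs_sub_le (hLip n)),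
      fun k hk x => ?_⟩
    rw [← mul_assoc L]
    exact ShakenControl.norm_iteratedFDeriv_mollify_le hδ hε (hLip n) hk x
  · have key := fun a (ha : a ∈ Q.A) =>
      ShakenControl.integral_mollifiedValue_euler (n := n) hQ hC₀ hB hT hN hδ hε hn x ha
    have : Nonempty Q.A := hQ.nonempty.to_subtype
    refine ⟨fun a ha => (key a ha).1,
      ⟨ShakenControl.mollifiedValue Q T N 𝓕 P B δ ε n x, ?_⟩, ciSup_le fun a => (key a a.2).2⟩
    rintro _ ⟨a, rfl⟩
    exact (key a a.2).2
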